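/- **Notation.** For $B\in\mathbb Z^{s\times(d+1)}$ let $g_\infty(B)$ be the largest $\ell_\infty$-norm of an element of the Graver basis of $B$ (the set of $\sqsubseteq$-minimal nonzero integer vectors in the kernel of $B$, where $x\sqsubseteq y$ means $x_jy_j\ge 0$ and $|x_j|\le|y_j|$ for all $j$); $g_\infty(B)=0$ if the Graver basis is empty. **(1) Balancing lemma.** Let $d,m,s\in\mathbb N$, let $A=(I_d\ \mathbf 0)\in\mathbb Z^{d\times(d+1)}$ and $B\in\mathbb Z^{s\times(d+1)}$, let $\mathcal A$ be the $n$-fold matrix with $m$ blocks $A$ side by side in its top rows and $m$ blocks $B$ on the diagonal below, and let $b\in\mathbb Z^{d+sm}$ be a right-hand side whose parts belonging to the $m$ diagonal blocks are all equal. If $\mathcal Ax=b$ has a nonnegative integer solution, then it has a nonnegative integer solution $x=(x^1,\dots,x^m)$, $x^i\in\mathbb Z^{d+1}$, with $\|x^i-x^{i'}\|_\infty\le 2d\,g_\infty(B)$ for all $i,i'\in[m]$. **(2) Kernel.** An instance consists of $d\ge1$ job types with processing times $p\in\mathbb N_{>0}^d$, numbers of jobs $n\in\mathbb N^d_{>0}$,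 a number $m\ge1$ of identical machines, and thresholds in $\mathbb N$; let $p_{\max}=\max_j p_j$. A schedule assigns each job to one machine. The question is whether there is a schedule in which - every load is at most $T$ (for $P\|C_{\max}$); - every load is at least $T$ (for $P\|C_{\min}$); - any two loads differ by at most $T$ (for $P\|C_{\mathrm{envy}}$); - every load lies in $[\ell,u]$ (for $P\|C_{\mathrm{envy}}$ with given bounds $\ell,u$ on the loads, i.e. load balancing). For each of these four decision problems there is a kernelization that maps every instance $I$ to an instance $I'$ of the same problem with the same $d$, $m$ and $p$, such that: - $I$ is a yes-instance if and only if $I'$ is one, and the encoding length of $I'$ is at most a computable function of $d+m+p_{\max}$; - if $I'$ is a yes-instance, then it has a solution in which, on each machine, the number of jobs of each type is at most $4d(4p_{\max}+1)^2$ and the load is at most $4d^2p_{\max}(4p_{\max}+1)^2$; - the job numbers of $I'$ satisfy $n'_j\le m\cdot 4d(4p_{\max}+1)^2$, and its thresholds are at most $4d^2p_{\max}(4p_{\max}+1)^2$; - there is $a\in\mathbb N^d$ with $n_j=n'_j+m\,a_j$ for all $j$, such that every solution of $I'$ becomes a solution of $I$ when $a_j$ further jobs of each type $j$ are assigned to every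 machine; - $I'$ is computed in time $O(d)$: one program of a random access machine (with addition, truncated subtraction, multiplication, integer division, indirect addressing, tests for zero, all of unit cost) computes $I'$ from $I$ in at most $C\,d$ steps, and every number that it writes is at most $N^C$, where $N$ is the sum of all numbers in $I$ (including $d$ and $m$) and $C$ is a constant that does not depend on $I$. -/

import Mathlib

/-! ### Graver bases and `n`-fold matrices -/

/-- The `ℓ_∞`-norm of an integer vector. -/
def linfNorm {ι : Type} [Fintype ι] (x : ι → ℤ) : ℕ :=
  Finset.univ.sup fun j => (x j).natAbs

/-- The sign-compatible order `x ⊑ y`: in every coordinate `x` and `y` do not have opposite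
signs, and `|x j| ≤ |y j|`. -/
def SignCompat {ι : Type} (x y : ι → ℤ) : Prop :=
  ∀ j, 0 ≤ x j * y j ∧ |x j| ≤ |y j|

/-- The Graver basis of `B`: the `⊑`-minimal nonzero integer vectors of the kernel of `B`. -/
def graverBasis {κ ι : Type} [Fintype ι] (B : Matrix κ ι ℤ) : Set (ι → ℤ) :=
  {g | g ≠ 0 ∧ B.mulVec g = 0 ∧
    ∀ h : ι → ℤ, h ≠ 0 → B.mulVec h = 0 → SignCompat h g → h = g}

theorem graverBasis_finite {κ ι : Type} [Fintype ι] (B : Matrix κ ι ℤ) :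
    (graverBasis B).Finite := by
  let φ : (ι → ℤ) → (ι → ℕ × ℕ) := fun x j => ((x j).toNat, (-(x j)).toNat)
  have hle : ∀ x y, φ x ≤ φ y → SignCompat x y := by
    intro x y h j
    have hj := h j
    simp only [φ, Prod.le_def] at hj
    obtain ⟨h1, h2⟩ := hj
    rcases le_total 0 (x j) with hx | hx <;> rcases le_total 0 (y j) with hy | hy
    · exact ⟨mul_nonneg hx hy, by rw [abs_of_nonneg hx, abs_of_nonneg hy]; omega⟩
    · have : x j = 0 := by omega
      simp [this]
    · have : x j = 0 := by omega
      simp [this]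
    · exact ⟨mul_nonneg_of_nonpos_of_nonpos hx hy,
        by rw [abs_of_nonpos hx, abs_of_nonpos hy]; omega⟩
  have hinj : Function.Injective φ := by
    intro x y h
    funext j
    have hj := congrFun h j
    simp only [φ, Prod.mk.injEq] at hj
    omega
  have hanti : IsAntichain (· ≤ ·) (φ '' graverBasis B) := by
    rintro _ ⟨x, hx, rfl⟩ _ ⟨y, hy, rfl⟩ hne h
    exact hne (congrArg φ (hy.2.2 x hx.1 hx.2.1 (hle x y h)))
  have hfin : (φ '' graverBasis B).Finite :=
    hanti.finite_of_partiallyWellOrderedOn (Set.isPWO_of_wellQuasiOrderedLE _)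
  exact hfin.of_finite_image hinj.injOn

/-- `g_∞(B)`: the largest `ℓ_∞`-norm of an element of the Graver basis of `B`
(`0` if the Graver basis is empty; the supremum is over a finite set). -/
noncomputable def gInf {κ ι : Type} [Fintype ι] (B : Matrix κ ι ℤ) : ℕ :=
  sSup (linfNorm '' graverBasis B)

/-- The `n`-fold matrix with `m` copies of `A` next to each other in the top rows and `m` copies
of `B` on the diagonal below. -/
def nFold {ρ κ ι : Type} (m : ℕ) (A : Matrix ρ ι ℤ) (B : Matrix κ ι ℤ) :
    Matrix (ρ ⊕ Fin m × κ) (Fin m × ι) ℤ :=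
  fun row col =>
    match row with
    | Sum.inl a => A a col.2
    | Sum.inr (i, k) => if i = col.1 then B k col.2 else 0

/-- The `d × (d+1)` matrix `(I_d 0)`. -/
def idZero (d : ℕ) : Matrix (Fin d) (Fin (d + 1)) ℤ :=
  fun a j => if j = a.castSucc then 1 else 0

/-- Feasible solutions of the feasibility ILP `M x = b`, `x` integral and nonnegative. -/
def IsFeasible {ρ ι : Type} [Fintype ι] (M : Matrix ρ ι ℤ) (b : ρ → ℤ) (x : ι → ℤ) : Prop :=
  M.mulVec x = b ∧ ∀ j, 0 ≤ x j

/-! ### Scheduling on identical machines -/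

/-- The decision problems: `cmax`, `cmin` and `envy` are the decision versions with one threshold
of `P||C_max`, `P||C_min` and `P||C_envy`; `window` is the version of `P||C_envy` in which a lower
and an upper bound on the loads are given (load balancing). -/
inductive Objective
  | cmax
  | cmin
  | envy
  | window

/-- The number of thresholds in an instance. -/
def Objective.arity : Objective → ℕ
  | .cmax => 1
  | .cmin => 1
  | .envy => 1
  | .window => 2

/-- The requirement on the machine loads, for given thresholds `T`. -/
def Objective.Meets {m : ℕ} : (o : Objective) → (Fin o.arity → ℕ) → (Fin m → ℕ) → Prop
  | .cmax, T, load => ∀ i, load i ≤ T (0 : Fin 1)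
  | .cmin, T, load => ∀ i, T (0 : Fin 1) ≤ load i
  | .envy, T, load => ∀ i i', load i ≤ load i' + T (0 : Fin 1)
  | .window, T, load => ∀ i, T (0 : Fin 2) ≤ load i ∧ load i ≤ T (1 : Fin 2)

/-- An instance with `d` job types and `m` machines: processing times `p`, job numbers `n`,
thresholds `T`. -/
structure Instance (o : Objective) (d m : ℕ) where
  p : Fin d → ℕ
  n : Fin d → ℕ
  T : Fin o.arity → ℕ
  d_pos : 0 < d
  m_pos : 0 < m
  p_pos : ∀ j, 0 < p j
  n_pos : ∀ j, 0 < n j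

namespace Instance

variable {o : Objective} {d m : ℕ}

/-- The largest processing time. -/
def pMax (I : Instance o d m) : ℕ := Finset.univ.sup I.p

/-- The load of machine `i`, if it gets `y i j` jobs of type `j`. -/
def load (I : Instance o d m) (y : Fin m → Fin d → ℕ) (i : Fin m) : ℕ :=
  ∑ j, I.p j * y i j

/-- `y` (machine `i` gets `y i j` jobs of type `j`) is a schedule, that is, every job is assigned
to exactly one machine, and it meets the thresholds. Jobs of one type are interchangeable. -/
def IsSolution (I : Instance o d m) (y : Fin m → Fin d → ℕ) : Prop :=
  (∀ j, ∑ i, y i j = I.n j) ∧ o.Meets I.T (I.load y)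

/-- `I` is a yes-instance. -/
def IsYes (I : Instance o d m) : Prop := ∃ y, I.IsSolution y

/-- The encoding length of an instance, all numbers in binary. -/
def size (I : Instance o d m) : ℕ :=
  Nat.size d + Nat.size m + ∑ j, (Nat.size (I.p j) + Nat.size (I.n j)) + ∑ k, Nat.size (I.T k)

/-- The sum of all numbers in an instance. -/
def total (I : Instance o d m) : ℕ :=
  d + m + ∑ j, (I.p j + I.n j) + ∑ k, I.T k

/-- The bound `4 d (4 p_max + 1)²`. -/
def jobBound (I : Instance o d m) : ℕ := 4 * d * (4 * I.pMax + 1) ^ 2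

/-- The bound `4 d² p_max (4 p_max + 1)²`. -/
def loadBound (I : Instance o d m) : ℕ := 4 * d ^ 2 * I.pMax * (4 * I.pMax + 1) ^ 2

end Instance

/-- `κ` is a kernel, up to its running time: the output is a yes-instance if and only if the input
is one, and the encoding length of the output is at most a computable function of the parameter
`d + m + p_max` of the input. -/
def IsKernelization {o : Objective}
    (κ : (d m : ℕ) → Instance o d m → Instance o d m) : Prop :=
  (∀ (d m : ℕ) (I : Instance o d m), I.IsYes ↔ (κ d m I).IsYes) ∧
  ∃ g : ℕ → ℕ, Computable g ∧
    ∀ (d m : ℕ) (I : Instance o d m), (κ d m I).size ≤ g (d + m + I.pMax)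

/-! ### Random access machines with a step count -/

/-- A state of the machine: registers and memory cells, all holding natural numbers. -/
structure RamState where
  reg : ℕ → ℕ
  mem : ℕ → ℕ

/-- Write the value `v` into register `r`. -/
def RamState.setReg (σ : RamState) (r v : ℕ) : RamState :=
  { σ with reg := Function.update σ.reg r v }

/-- Write the value `v` into the memory cell with address `a`. -/
def RamState.setMem (σ : RamState) (a v : ℕ) : RamState :=
  { σ with mem := Function.update σ.mem a v }

/-- The arithmetic instructions. -/
inductive RamOp
  | add
  | sub
  | mul
  | div

/-- Subtraction is truncated at `0`, division is rounded down. -/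
def RamOp.eval : RamOp → ℕ → ℕ → ℕ
  | .add, x, y => x + y
  | .sub, x, y => x - y
  | .mul, x, y => x * y
  | .div, x, y => x / y

/-- Programs. -/
inductive RamProg
  /-- `reg r := c` -/
  | const (r c : ℕ)
  /-- `reg r := reg a op reg b` -/
  | arith (op : RamOp) (r a b : ℕ)
  /-- `reg r := mem (reg a)` -/
  | load (r a : ℕ)
  /-- `mem (reg a) := reg r` -/
  | store (a r : ℕ)
  /-- First `P`, then `Q`. -/
  | seq (P Q : RamProg)
  /-- If `reg r ≠ 0` then `P`, else `Q`. -/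
  | cond (r : ℕ) (P Q : RamProg)
  /-- As long as `reg r ≠ 0`, repeat `P`. -/
  | loop (r : ℕ) (P : RamProg)

/-- `P.Runs W σ t τ`: the program `P`, started in the state `σ`, halts in the state `τ` after
exactly `t` steps, and no number larger than `W` is written on the way. Every instruction and every
test is one step. -/
inductive RamProg.Runs (W : ℕ) : RamProg → RamState → ℕ → RamState → Prop
  | const (r c : ℕ) (σ : RamState) (h : c ≤ W) :
      Runs W (.const r c) σ 1 (σ.setReg r c)
  | arith (op : RamOp) (r a b : ℕ) (σ : RamState) (h : op.eval (σ.reg a) (σ.reg b) ≤ W) :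
      Runs W (.arith op r a b) σ 1 (σ.setReg r (op.eval (σ.reg a) (σ.reg b)))
  | load (r a : ℕ) (σ : RamState) (h : σ.mem (σ.reg a) ≤ W) :
      Runs W (.load r a) σ 1 (σ.setReg r (σ.mem (σ.reg a)))
  | store (a r : ℕ) (σ : RamState) (h : σ.reg r ≤ W) :
      Runs W (.store a r) σ 1 (σ.setMem (σ.reg a) (σ.reg r))
  | seq (P Q : RamProg) (σ τ υ : RamState) (s t : ℕ)
      (hP : Runs W P σ s τ) (hQ : Runs W Q τ t υ) :
      Runs W (.seq P Q) σ (s + t) υ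
  | cond_true (r : ℕ) (P Q : RamProg) (σ τ : RamState) (t : ℕ) (h : σ.reg r ≠ 0)
      (hP : Runs W P σ t τ) :
      Runs W (.cond r P Q) σ (t + 1) τ
  | cond_false (r : ℕ) (P Q : RamProg) (σ τ : RamState) (t : ℕ) (h : σ.reg r = 0)
      (hQ : Runs W Q σ t τ) :
      Runs W (.cond r P Q) σ (t + 1) τ
  | loop_stop (r : ℕ) (P : RamProg) (σ : RamState) (h : σ.reg r = 0) :
      Runs W (.loop r P) σ 1 σ
  | loop_step (r : ℕ) (P : RamProg) (σ τ υ : RamState) (s t : ℕ) (h : σ.reg r ≠ 0)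
      (hP : Runs W P σ s τ) (hL : Runs W (.loop r P) τ t υ) :
      Runs W (.loop r P) σ (s + t + 1) υ

/-- The input state: `d`, `m` and the thresholds are in the registers `0, 1, 2, …`, then zeros;
the processing times and the job numbers are in the memory cells `0, …, d-1` and `d, …, 2d-1`,
then zeros. -/
def Instance.inputState {o : Objective} {d m : ℕ} (I : Instance o d m) : RamState where
  reg r :=
    if r = 0 then d
    else if r = 1 then m
    else if h : r - 2 < o.arity then I.T ⟨r - 2, h⟩
    else 0
  mem a :=
    if h : a < d then I.p ⟨a, h⟩
    else if h : a - d < d then I.n ⟨a - d, h⟩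
    else 0

/-- The state `σ` holds the instance `I`, in the layout of the input state; the content of all
other registers and cells is arbitrary. -/
def Instance.StoredIn {o : Objective} {d m : ℕ} (I : Instance o d m) (σ : RamState) : Prop :=
  σ.reg 0 = d ∧ σ.reg 1 = m ∧ (∀ k : Fin o.arity, σ.reg (2 + k) = I.T k) ∧
  (∀ j : Fin d, σ.mem j = I.p j) ∧ (∀ j : Fin d, σ.mem (d + j) = I.n j)

/-- `κ` is computed in time `O(d)`: one program computes it with at most `C d` steps on every
instance with `d` job types, for a constant `C`. All numbers that occur are polynomially bounded in
the numbers of the input (words of logarithmic length), so that this is also polynomial time in the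
encoding length. -/
def ComputableInLinearTime {o : Objective}
    (κ : (d m : ℕ) → Instance o d m → Instance o d m) : Prop :=
  ∃ (P : RamProg) (C : ℕ), ∀ (d m : ℕ) (I : Instance o d m),
    ∃ (t : ℕ) (σ : RamState), t ≤ C * d ∧ P.Runs (I.total ^ C) I.inputState t σ ∧
      (κ d m I).StoredIn σ

/-!
**Balancing.** Let `x` and `x'` be two bricks of a solution with the same image under `B`. Their
difference lies in the kernel of `B`, hence is a nonnegative combination of elements of the Graver
basis that are sign-compatible with it (`exists_sum_graverBasis`), and by Carathéodory's theorem for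
cones (`exists_conic_combination_card_le`) at most as many elements as `B` has columns are needed,
with rational coefficients. Rounding half of every coefficient to the nearest integer gives an
integer vector `e` of the kernel, sign-compatible with the difference, such that `x - e` and `x' + e`
differ by at most the number of columns times `gInf B` (`exists_half`). Their entries lie between
those of `x` and `x'`, and their sum is `x + x'`. So a solution with the least sum of squares is
balanced (`exists_balanced`). For the matrix `(I_d 0)` there are `d + 1 ≤ 2 d` columns if `0 < d`;
if `d = 0`, all bricks may be taken equal.

**The kernel.** Loads in an interval are described by the row `(p, 1)`, with a slack in the last
column that has an upper bound; balancing respects such bounds. The entries of the Graver basis of a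
positive row are at most the largest entry of the row (`gInf_row_le`), which follows from the fact
that among `q` numbers there is a nonempty selection whose sum is divisible by `q`
(`exists_le_dvd_sum`). So a yes-instance has a solution in which any two machines differ by at most
`H = 2 d (4 p_max + 1)²` jobs of each type, whatever the objective
(`Instance.IsYes.exists_balanced`). In it, every machine has at least `⌊n j / m⌋ - H` jobs of type
`j`. The kernel assigns these in advance and lowers the thresholds by the resulting load; what is
left of the balanced solution has at most `2 H` jobs of each type on each machine, so that the
thresholds can be cut off at `2 H d p_max`. Conversely, a threshold that is truncated at `0` or cut
off creates no new solutions, because a positive, but not too large, number of jobs is left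
(`Instance.isSolution_of_kernel`).

**The running time.** The program needs two passes over the job types, one for the largest
processing time and one for the job numbers. Its steps are followed symbolically with the relation
`RamProg.Reaches`; loops count down a register and are treated by an invariant
(`RamProg.Reaches.countdown`).
-/

/-! ### Sign-compatible vectors and the Graver basis -/

theorem signCompat_iff {ι : Type} {x y : ι → ℤ} :
    SignCompat x y ↔ ∀ j, (0 ≤ x j ∧ x j ≤ y j) ∨ (y j ≤ x j ∧ x j ≤ 0) := by
  refine forall_congr' fun j => ?_
  rcases lt_trichotomy (x j) 0 with hx | hx | hx
  · constructor
    · rintro ⟨h1, h2⟩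
      have hy : y j ≤ 0 := by by_contra hy; push Not at hy; nlinarith
      rw [abs_of_neg hx, abs_of_nonpos hy] at h2
      omega
    · intro h
      have hy : y j ≤ x j := by omega
      exact ⟨mul_nonneg_of_nonpos_of_nonpos hx.le (by omega),
        by rw [abs_of_neg hx, abs_of_nonpos (by omega)]; omega⟩
  · simp only [hx, zero_mul, le_refl, abs_zero, abs_nonneg, and_self, true_and, and_true, true_iff]
    omega
  · constructor
    · rintro ⟨h1, h2⟩
      have hy : 0 ≤ y j := by by_contra hy; push Not at hy; nlinarith
      rw [abs_of_pos hx, abs_of_nonneg hy] at h2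
      omega
    · intro h
      have hy : x j ≤ y j := by omega
      exact ⟨mul_nonneg hx.le (by omega),
        by rw [abs_of_pos hx, abs_of_nonneg (by omega)]; omega⟩

theorem SignCompat.trans {ι : Type} {x y z : ι → ℤ} (hxy : SignCompat x y) (hyz : SignCompat y z) :
    SignCompat x z := by
  rw [signCompat_iff] at *
  intro j
  have := hxy j
  have := hyz j
  omega

theorem SignCompat.neg {ι : Type} {x y : ι → ℤ} (h : SignCompat x y) : SignCompat (-x) (-y) := by
  intro j
  simpa using h j

theorem neg_mem_graverBasis {κ ι : Type} [Fintype ι] {B : Matrix κ ι ℤ} {g : ι → ℤ}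
    (hg : g ∈ graverBasis B) : -g ∈ graverBasis B := by
  refine ⟨neg_ne_zero.2 hg.1, by rw [Matrix.mulVec_neg, hg.2.1, neg_zero], fun h h0 hB hc => ?_⟩
  rw [← hg.2.2 (-h) (neg_ne_zero.2 h0) (by rw [Matrix.mulVec_neg, hB, neg_zero])
    (by simpa using hc.neg), neg_neg]

theorem abs_le_gInf {κ ι : Type} [Fintype ι] {B : Matrix κ ι ℤ} {g : ι → ℤ}
    (hg : g ∈ graverBasis B) (j : ι) : |g j| ≤ gInf B := by
  have h1 : (g j).natAbs ≤ linfNorm g :=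
    Finset.le_sup (f := fun j => (g j).natAbs) (Finset.mem_univ j)
  have h2 : linfNorm g ≤ gInf B :=
    le_csSup ((graverBasis_finite B).image _).bddAbove ⟨g, hg, rfl⟩
  rw [Int.abs_eq_natAbs]
  exact_mod_cast h1.trans h2

theorem gInf_le {κ ι : Type} [Fintype ι] {B : Matrix κ ι ℤ} {c : ℕ}
    (h : ∀ g ∈ graverBasis B, ∀ j, g j ≤ c) : gInf B ≤ c := by
  rw [gInf]
  rcases (linfNorm '' graverBasis B).eq_empty_or_nonempty with h0 | h0
  · simp [h0]
  · refine csSup_le h0 ?_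
    rintro _ ⟨g, hg, rfl⟩
    refine Finset.sup_le fun j _ => ?_
    have h1 := h g hg j
    have h2 := h (-g) (neg_mem_graverBasis hg) j
    rw [Pi.neg_apply] at h2
    omega

theorem exists_graverBasis_signCompat {κ ι : Type} [Fintype ι] {B : Matrix κ ι ℤ} {x : ι → ℤ}
    (hx : x ≠ 0) (hB : B.mulVec x = 0) : ∃ g ∈ graverBasis B, SignCompat g x := by
  let N : (ι → ℤ) → ℕ := fun y => ∑ j, (y j).natAbs
  let S : Set (ι → ℤ) := {h | h ≠ 0 ∧ B.mulVec h = 0 ∧ SignCompat h x}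
  have hS : S.Nonempty := ⟨x, hx, hB, fun j => ⟨mul_self_nonneg _, le_rfl⟩⟩
  obtain ⟨hg0, hgB, hgx⟩ := Function.argminOn_mem N S hS
  set g := Function.argminOn N S hS with hg
  refine ⟨g, ⟨hg0, hgB, fun h h0 hhB hhg => ?_⟩, hgx⟩
  have hmin : N g ≤ N h := Function.argminOn_le N S ⟨h0, hhB, hhg.trans hgx⟩
  rw [signCompat_iff] at hhg
  have hle : ∀ j ∈ Finset.univ, (h j).natAbs ≤ (g j).natAbs := fun j _ => by
    have := hhg j
    omega
  have heq := (Finset.sum_eq_sum_iff_of_le hle).1 (le_antisymm (Finset.sum_le_sum hle) hmin)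
  funext j
  have h1 := heq j (Finset.mem_univ j)
  have h2 := hhg j
  omega

/-- Every integer vector in the kernel is a nonnegative integer combination of elements of the
Graver basis that are sign-compatible with it. -/
theorem exists_sum_graverBasis {κ ι : Type} [Fintype ι] {B : Matrix κ ι ℤ} {x : ι → ℤ}
    (hB : B.mulVec x = 0) :
    ∃ (t : Finset (ι → ℤ)) (c : (ι → ℤ) → ℕ),
      (∀ g ∈ t, g ∈ graverBasis B ∧ SignCompat g x) ∧ x = ∑ g ∈ t, c g • g := by
  classical
  induction hn : ∑ j, (x j).natAbs using Nat.strong_induction_on generalizing x with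
  | _ n ih =>
    by_cases hx : x = 0
    · exact ⟨∅, 0, by simp, by simp [hx]⟩
    obtain ⟨g, hg, hgx⟩ := exists_graverBasis_signCompat hx hB
    have hgx' := signCompat_iff.1 hgx
    have hsub : SignCompat (x - g) x := signCompat_iff.2 fun j => by
      have := hgx' j
      rw [Pi.sub_apply]
      omega
    have hlt : ∑ j, ((x - g) j).natAbs < n := by
      rw [← hn]
      obtain ⟨j, hj⟩ := Function.ne_iff.1 hg.1
      refine Finset.sum_lt_sum (fun j _ => ?_) ⟨j, Finset.mem_univ j, ?_⟩
      · have := hgx' j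
        rw [Pi.sub_apply]
        omega
      · have := hgx' j
        rw [Pi.zero_apply] at hj
        rw [Pi.sub_apply]
        omega
    obtain ⟨t, c, ht, hsum⟩ :=
      ih _ hlt (x := x - g) (by rw [Matrix.mulVec_sub, hB, hg.2.1, sub_zero]) rfl
    by_cases hgt : g ∈ t
    · refine ⟨t, Function.update c g (c g + 1), fun h hh => ⟨(ht h hh).1, (ht h hh).2.trans hsub⟩, ?_⟩
      rw [← Finset.add_sum_erase t _ hgt] at hsum ⊢
      rw [Finset.sum_congr rfl fun h hh => by
        rw [Function.update_of_ne (Finset.ne_of_mem_erase hh)], Function.update_self, add_smul,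
        one_smul, add_right_comm, ← hsum, sub_add_cancel]
    · refine ⟨insert g t, Function.update c g 1, fun h hh => ?_, ?_⟩
      · rcases Finset.mem_insert.1 hh with rfl | hh
        · exact ⟨hg, hgx⟩
        · exact ⟨(ht h hh).1, (ht h hh).2.trans hsub⟩
      · rw [Finset.sum_insert hgt, Finset.sum_congr rfl fun h hh => by
          rw [Function.update_of_ne (ne_of_mem_of_not_mem hh hgt)], Function.update_self, one_smul,
          ← hsum, add_sub_cancel]

/-! ### Carathéodory's theorem for cones -/

/-- A nonnegative combination of vectors of a finite-dimensional space is also one of at most as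
many of them as the dimension. -/
theorem exists_conic_combination_card_le {𝕜 V α : Type*} [Field 𝕜] [LinearOrder 𝕜]
    [IsStrictOrderedRing 𝕜] [AddCommGroup V] [Module 𝕜 V] [FiniteDimensional 𝕜 V] (v : α → V)
    (t : Finset α) (w : α → 𝕜) (hw : ∀ a ∈ t, 0 ≤ w a) :
    ∃ s ⊆ t, ∃ w' : α → 𝕜, s.card ≤ Module.finrank 𝕜 V ∧ (∀ a ∈ s, 0 ≤ w' a) ∧
      ∑ a ∈ s, w' a • v a = ∑ a ∈ t, w a • v a := by
  classical
  induction hn : t.card generalizing t w with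
  | zero => exact ⟨t, subset_rfl, w, by omega, hw, rfl⟩
  | succ n ih =>
    by_cases hli : LinearIndepOn 𝕜 v (t : Set α)
    · refine ⟨t, subset_rfl, w, ?_, hw, rfl⟩
      have := LinearIndependent.fintype_card_le_finrank hli
      simpa using this
    obtain ⟨f, hf, hpos⟩ : ∃ f : α → 𝕜, ∑ a ∈ t, f a • v a = 0 ∧ ∃ a ∈ t, 0 < f a := by
      obtain ⟨f, hf, a, ha, hfa⟩ := not_linearIndepOn_finset_iff.1 hli
      rcases hfa.lt_or_gt with h | h
      · exact ⟨-f, by simp [hf], a, ha, by simpa using h⟩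
      · exact ⟨f, hf, a, ha, h⟩
    have hne : (t.filter fun a => 0 < f a).Nonempty := by
      obtain ⟨a, ha, h⟩ := hpos
      exact ⟨a, Finset.mem_filter.2 ⟨ha, h⟩⟩
    -- The largest multiple of the relation that keeps all coefficients nonnegative removes a vector.
    obtain ⟨b, hb, hmin⟩ := Finset.exists_min_image _ (fun a => w a / f a) hne
    rw [Finset.mem_filter] at hb
    set q := w b / f b with hq
    have hq0 : 0 ≤ q := div_nonneg (hw b hb.1) hb.2.le
    have hw' : ∀ a ∈ t, 0 ≤ w a - q * f a := by
      intro a ha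
      rcases le_or_gt (f a) 0 with h | h
      · nlinarith [hw a ha]
      · have := hmin a (Finset.mem_filter.2 ⟨ha, h⟩)
        rw [le_div_iff₀ h] at this
        linarith
    obtain ⟨s, hs, w', hcard, hw'', hsum⟩ := ih (t.erase b) (fun a => w a - q * f a)
      (fun a ha => hw' a (Finset.mem_of_mem_erase ha)) (by
        rw [Finset.card_erase_of_mem hb.1]; omega)
    refine ⟨s, hs.trans (Finset.erase_subset _ _), w', hcard, hw'', hsum.trans ?_⟩
    have hb0 : (w b - q * f b) • v b = 0 := by
      rw [hq, div_mul_cancel₀ _ hb.2.ne', sub_self, zero_smul]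
    rw [← zero_add (∑ a ∈ t.erase b, _), ← hb0,
      Finset.add_sum_erase t (fun a => (w a - q * f a) • v a) hb.1]
    simp only [sub_smul, mul_smul, Finset.sum_sub_distrib, ← Finset.smul_sum, hf, smul_zero,
      sub_zero]

/-! ### Balancing -/

/-- An integer vector `x` of the kernel is split almost evenly into two sign-compatible integer
vectors of the kernel: write `x` as a conic combination of few elements of the Graver basis and
round half of every coefficient to the nearest integer. -/
theorem exists_half {κ ι : Type} [Fintype ι] {B : Matrix κ ι ℤ} {x : ι → ℤ}
    (hB : B.mulVec x = 0) :
    ∃ e : ι → ℤ, B.mulVec e = 0 ∧ SignCompat e x ∧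
      ∀ j, |x j - 2 * e j| ≤ Fintype.card ι * gInf B := by
  obtain ⟨t, c, ht, hx⟩ := exists_sum_graverBasis hB
  obtain ⟨s, hst, w, hcard, hw, hsum⟩ := exists_conic_combination_card_le (𝕜 := ℚ)
    (fun (g : ι → ℤ) (j : ι) => (g j : ℚ)) t (fun g => c g) (fun _ _ => Nat.cast_nonneg _)
  rw [Module.finrank_fintype_fun_eq_card] at hcard
  have hxj : ∀ j, (x j : ℚ) = ∑ g ∈ s, w g * g j := by
    intro j
    have h := congrFun hsum j
    simp only [Finset.sum_apply, Pi.smul_apply, smul_eq_mul] at h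
    rw [h, hx]
    simp
  let r : (ι → ℤ) → ℤ := fun g => ⌊w g / 2 + 1 / 2⌋
  have hr0 : ∀ g ∈ s, 0 ≤ r g := fun g hg => Int.floor_nonneg.2 (by linarith [hw g hg])
  -- Rounding half of a nonnegative number to the nearest integer does not exceed the number.
  have hrw : ∀ g ∈ s, (r g : ℚ) ≤ w g := by
    intro g hg
    have h1 : (r g : ℚ) ≤ w g / 2 + 1 / 2 := Int.floor_le _
    rcases (hr0 g hg).eq_or_lt with h | h
    · rw [← h]; simpa using hw g hg
    · have : (1 : ℚ) ≤ r g := by exact_mod_cast h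
      linarith
  have hrd : ∀ g ∈ s, |w g - 2 * r g| ≤ 1 := by
    intro g _
    have h1 : (r g : ℚ) ≤ w g / 2 + 1 / 2 := Int.floor_le _
    have h2 : w g / 2 + 1 / 2 < r g + 1 := Int.lt_floor_add_one _
    rw [abs_le]
    constructor <;> linarith
  let e : ι → ℤ := ∑ g ∈ s, r g • g
  have hej : ∀ j, e j = ∑ g ∈ s, r g * g j := by simp [e]
  refine ⟨e, ?_, signCompat_iff.2 fun j => ?_, fun j => ?_⟩
  · rw [Matrix.mulVec_sum]
    refine Finset.sum_eq_zero fun g hg => ?_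
    rw [Matrix.mulVec_smul, (ht g (hst hg)).1.2.1, smul_zero]
  · have hs := fun g hg => signCompat_iff.1 (ht g (hst hg)).2 j
    rw [hej]
    rcases le_total 0 (x j) with h | h
    · have hg0 : ∀ g ∈ s, 0 ≤ g j := fun g hg => by have := hs g hg; omega
      refine Or.inl ⟨Finset.sum_nonneg fun g hg => mul_nonneg (hr0 g hg) (hg0 g hg), ?_⟩
      rw [← Int.cast_le (R := ℚ), hxj]
      push_cast
      exact Finset.sum_le_sum fun g hg =>
        mul_le_mul_of_nonneg_right (hrw g hg) (by exact_mod_cast hg0 g hg)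
    · have hg0 : ∀ g ∈ s, g j ≤ 0 := fun g hg => by have := hs g hg; omega
      refine Or.inr ⟨?_, Finset.sum_nonpos fun g hg =>
        mul_nonpos_of_nonneg_of_nonpos (hr0 g hg) (hg0 g hg)⟩
      rw [← Int.cast_le (R := ℚ), hxj]
      push_cast
      exact Finset.sum_le_sum fun g hg =>
        mul_le_mul_of_nonpos_right (hrw g hg) (by exact_mod_cast hg0 g hg)
  · have h : |(x j : ℚ) - 2 * e j| ≤ Fintype.card ι * gInf B := by
      rw [hxj, hej]
      push_cast
      rw [Finset.mul_sum, ← Finset.sum_sub_distrib]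
      calc |∑ g ∈ s, (w g * g j - 2 * (r g * g j))|
          ≤ ∑ g ∈ s, |w g * g j - 2 * (r g * g j)| := Finset.abs_sum_le_sum_abs _ _
        _ ≤ ∑ g ∈ s, (gInf B : ℚ) := Finset.sum_le_sum fun g hg => by
            rw [← mul_assoc, ← sub_mul, abs_mul]
            have h1 : |(g j : ℚ)| ≤ gInf B := by
              exact_mod_cast abs_le_gInf (ht g (hst hg)).1 j
            calc _ ≤ 1 * |(g j : ℚ)| := mul_le_mul_of_nonneg_right (hrd g hg) (abs_nonneg _)
              _ ≤ _ := by rwa [one_mul]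
        _ = s.card * gInf B := by rw [Finset.sum_const, nsmul_eq_mul]
        _ ≤ _ := by gcongr
    exact_mod_cast h

/-- The general balancing lemma. If all bricks `x i` have the same image under `B`, the bricks can
be made almost equal without changing their images, their sum, or the intervals that contain their
entries. Among all such families, one with the least sum of squares is almost balanced: otherwise,
moving half of the difference of two bricks (`exists_half`) from one to the other decreases it. -/
theorem exists_balanced {α κ ι : Type} [Fintype α] [Fintype ι] (B : Matrix κ ι ℤ)
    (S : ι → Set ℤ) (hS : ∀ j, (S j).OrdConnected) (c : κ → ℤ) (x : α → ι → ℤ)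
    (hxB : ∀ i, B.mulVec (x i) = c) (hxS : ∀ i j, x i j ∈ S j) :
    ∃ y : α → ι → ℤ, (∀ i, B.mulVec (y i) = c) ∧ (∀ i j, y i j ∈ S j) ∧
      (∀ j, ∑ i, y i j = ∑ i, x i j) ∧
      ∀ i i' j, |y i j - y i' j| ≤ Fintype.card ι * gInf B := by
  classical
  let F : Set (α → ι → ℤ) := {y | (∀ i, B.mulVec (y i) = c) ∧ (∀ i j, y i j ∈ S j) ∧
    ∀ j, ∑ i, y i j = ∑ i, x i j}
  let φ : (α → ι → ℤ) → ℤ := fun y => ∑ j, ∑ i, y i j ^ 2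
  have hφ : ∀ y, 0 ≤ φ y := fun y =>
    Finset.sum_nonneg fun _ _ => Finset.sum_nonneg fun _ _ => sq_nonneg _
  have hF : F.Nonempty := ⟨x, hxB, hxS, fun _ => rfl⟩
  have hyF := Function.argminOn_mem (fun y => (φ y).toNat) F hF
  set y := Function.argminOn (fun y => (φ y).toNat) F hF with hy
  obtain ⟨hyB, hyS, hysum⟩ := hyF
  refine ⟨y, hyB, hyS, hysum, ?_⟩
  by_contra! hcon
  obtain ⟨a, b, j₀, hj₀⟩ := hcon
  have hab : a ≠ b := by
    rintro rfl
    rw [sub_self, abs_zero] at hj₀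
    have : (0 : ℤ) ≤ Fintype.card ι * gInf B := by positivity
    omega
  obtain ⟨e, heB, hec, he⟩ := exists_half (B := B) (x := y a - y b)
    (by rw [Matrix.mulVec_sub, hyB, hyB, sub_self])
  rw [signCompat_iff] at hec
  simp only [Pi.sub_apply] at hec he
  let z : α → ι → ℤ := fun k => y k + ((if k = b then e else 0) - if k = a then e else 0)
  have hza : z a = y a - e := by simp [z, hab, sub_eq_add_neg]
  have hzb : z b = y b + e := by simp [z, hab.symm]
  have hz : ∀ k, k ≠ a → k ≠ b → z k = y k := fun k h1 h2 => by simp [z, h1, h2]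
  have hzj : ∀ k j, z k j = y k j + ((if k = b then e j else 0) - if k = a then e j else 0) := by
    intro k j
    simp only [z, Pi.add_apply, Pi.sub_apply]
    split_ifs <;> rfl
  have hzF : z ∈ F := by
    refine ⟨fun k => ?_, fun k j => ?_, fun j => ?_⟩
    · by_cases h1 : k = a
      · rw [h1, hza, Matrix.mulVec_sub, heB, sub_zero, hyB]
      by_cases h2 : k = b
      · rw [h2, hzb, Matrix.mulVec_add, heB, add_zero, hyB]
      rw [hz k h1 h2, hyB]
    · have hbtw := hec j
      by_cases h1 : k = a
      · rw [h1, hza, Pi.sub_apply]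
        rcases hbtw with h | h
        · exact (hS j).out (hyS b j) (hyS a j) ⟨by omega, by omega⟩
        · exact (hS j).out (hyS a j) (hyS b j) ⟨by omega, by omega⟩
      by_cases h2 : k = b
      · rw [h2, hzb, Pi.add_apply]
        rcases hbtw with h | h
        · exact (hS j).out (hyS b j) (hyS a j) ⟨by omega, by omega⟩
        · exact (hS j).out (hyS a j) (hyS b j) ⟨by omega, by omega⟩
      rw [hz k h1 h2]
      exact hyS k j
    · rw [← hysum j]
      simp [hzj, Finset.sum_add_distrib]
  have hcol : ∀ j, ∑ i, z i j ^ 2 = ∑ i, y i j ^ 2 - 2 * (e j * (y a j - y b j - e j)) := by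
    intro j
    have : ∀ i, z i j ^ 2 = y i j ^ 2 + ((if i = b then 2 * y b j * e j + e j ^ 2 else 0) +
        if i = a then - (2 * y a j * e j) + e j ^ 2 else 0) := by
      intro i
      rw [hzj]
      by_cases h1 : i = a
      · subst h1
        simp only [hab, if_false, if_true]
        ring
      by_cases h2 : i = b
      · subst h2
        simp only [h1, if_false, if_true]
        ring
      simp [h1, h2]
    simp only [this, Finset.sum_add_distrib, Finset.sum_ite_eq', Finset.mem_univ, if_true]
    ring
  have hlt : φ z < φ y := by
    refine Finset.sum_lt_sum (fun j _ => ?_) ⟨j₀, Finset.mem_univ _, ?_⟩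
    · have : 0 ≤ e j * (y a j - y b j - e j) := by
        rcases hec j with h | h
        · exact mul_nonneg h.1 (by omega)
        · exact mul_nonneg_of_nonpos_of_nonpos h.2 (by omega)
      rw [hcol]
      omega
    · have : 0 < e j₀ * (y a j₀ - y b j₀ - e j₀) := by
        have h1 := (he j₀).trans_lt hj₀
        rcases hec j₀ with h | h
        · rw [abs_of_nonneg (a := y a j₀ - y b j₀) (by omega), abs_lt] at h1
          exact mul_pos (by omega) (by omega)
        · rw [abs_of_nonpos (a := y a j₀ - y b j₀) (by omega), abs_lt] at h1
          exact mul_pos_of_neg_of_neg (by omega) (by omega)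
      rw [hcol]
      omega
  have hmin : (φ y).toNat ≤ (φ z).toNat := Function.argminOn_le (fun y => (φ y).toNat) F hzF
  have := hφ z
  omega

/-! ### Balanced solutions of `n`-fold programs -/

theorem nFold_mulVec_inl {ρ κ ι : Type} [Fintype ι] (m : ℕ) (A : Matrix ρ ι ℤ) (B : Matrix κ ι ℤ)
    (x : Fin m × ι → ℤ) (a : ρ) :
    (nFold m A B).mulVec x (Sum.inl a) = ∑ i, A.mulVec (fun j => x (i, j)) a := by
  simp only [Matrix.mulVec, dotProduct, Fintype.sum_prod_type, nFold]

theorem nFold_mulVec_inr {ρ κ ι : Type} [Fintype ι] (m : ℕ) (A : Matrix ρ ι ℤ) (B : Matrix κ ι ℤ)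
    (x : Fin m × ι → ℤ) (i : Fin m) (k : κ) :
    (nFold m A B).mulVec x (Sum.inr (i, k)) = B.mulVec (fun j => x (i, j)) k := by
  simp only [Matrix.mulVec, dotProduct, Fintype.sum_prod_type, nFold, ite_mul, zero_mul]
  rw [Finset.sum_eq_single i (fun i' _ h => by simp [h.symm]) (by simp)]
  simp

theorem idZero_mulVec {d : ℕ} (x : Fin (d + 1) → ℤ) (a : Fin d) :
    (idZero d).mulVec x a = x a.castSucc := by
  simp [Matrix.mulVec, dotProduct, idZero]

theorem exists_balanced_nFold (d m s : ℕ) (B : Matrix (Fin s) (Fin (d + 1)) ℤ)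
    (b : Fin d ⊕ Fin m × Fin s → ℤ)
    (hb : ∀ (i i' : Fin m) (k : Fin s), b (Sum.inr (i, k)) = b (Sum.inr (i', k)))
    (hx : ∃ x, IsFeasible (nFold m (idZero d) B) b x) :
    ∃ x : Fin m × Fin (d + 1) → ℤ, IsFeasible (nFold m (idZero d) B) b x ∧
      ∀ i i' : Fin m,
        linfNorm ((fun j => x (i, j)) - (fun j => x (i', j))) ≤ 2 * d * gInf B := by
  obtain ⟨x, hx, hx0⟩ := hx
  rcases Nat.eq_zero_or_pos m with rfl | hm
  · exact ⟨x, ⟨hx, hx0⟩, fun i => i.elim0⟩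
  have hxA : ∀ a : Fin d, ∑ i, x (i, a.castSucc) = b (Sum.inl a) := fun a => by
    rw [← hx, nFold_mulVec_inl]
    simp only [idZero_mulVec]
  have hxB : ∀ i, B.mulVec (fun j => x (i, j)) = fun k => b (Sum.inr (⟨0, hm⟩, k)) := by
    intro i
    funext k
    rw [hb _ i k, ← hx, nFold_mulVec_inr]
  -- It remains to find bricks with the right images and the right sums of the first `d` entries.
  suffices h : ∃ y : Fin m → Fin (d + 1) → ℤ,
      (∀ i, B.mulVec (y i) = fun k => b (Sum.inr (⟨0, hm⟩, k))) ∧ (∀ i j, 0 ≤ y i j) ∧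
      (∀ a : Fin d, ∑ i, y i a.castSucc = ∑ i, x (i, a.castSucc)) ∧
      ∀ i i' j, |y i j - y i' j| ≤ 2 * d * gInf B by
    obtain ⟨y, hyB, hy0, hysum, hy⟩ := h
    refine ⟨fun q => y q.1 q.2, ⟨?_, fun q => hy0 _ _⟩, fun i i' => ?_⟩
    · funext q
      rcases q with a | ⟨i, k⟩
      · rw [nFold_mulVec_inl]
        simp only [idZero_mulVec]
        rw [hysum, hxA]
      · rw [nFold_mulVec_inr, hb i ⟨0, hm⟩ k]
        exact congrFun (hyB i) k
    · refine Finset.sup_le fun j _ => ?_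
      have := hy i i' j
      zify
      simpa using this
  rcases Nat.eq_zero_or_pos d with rfl | hd
  · -- Without rows of `A`, all bricks may be chosen equal.
    exact ⟨fun _ j => x (⟨0, hm⟩, j), fun _ => hxB _, fun _ _ => hx0 _, fun a => a.elim0,
      fun i i' j => by simp⟩
  · obtain ⟨y, hyB, hyS, hysum, hy⟩ := exists_balanced B (fun _ => Set.Ici 0)
      (fun _ => Set.ordConnected_Ici) _ (fun i j => x (i, j)) hxB (fun i j => hx0 _)
    refine ⟨y, hyB, hyS, fun a => hysum _, fun i i' j => (hy i i' j).trans ?_⟩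
    rw [Fintype.card_fin]
    exact mul_le_mul_of_nonneg_right (by push_cast; omega) (by positivity)

/-! ### The Graver basis of a positive row -/

/-- Among `q` items with weights, some nonempty selection has a total weight divisible by `q`;
here the items are given by the number `v j` of items with weight `p j`. -/
theorem exists_le_dvd_sum {ι : Type} [Fintype ι] (p v : ι → ℕ) {q : ℕ} (hq : 0 < q)
    (hv : q ≤ ∑ j, v j) :
    ∃ h : ι → ℕ, h ≤ v ∧ h ≠ 0 ∧ ∑ j, h j ≤ q ∧ q ∣ ∑ j, p j * h j := by
  classical
  obtain ⟨f⟩ : Nonempty (Fin q ↪ Σ j, Fin (v j)) :=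
    Function.Embedding.nonempty_of_card_le (by simpa using hv)
  let I : ℕ → Finset (Fin q) := fun k => Finset.univ.filter fun t => t.val < k
  let w : Fin q → ℕ := fun t => p (f t).1
  -- Two of the `q + 1` sums of initial segments of the items are congruent modulo `q`.
  obtain ⟨k, l, hkl, hl, hmod⟩ : ∃ k l, k < l ∧ l ≤ q ∧
      (∑ t ∈ I k, w t) % q = (∑ t ∈ I l, w t) % q := by
    obtain ⟨k, hk, l, hl, hne, heq⟩ := Finset.exists_ne_map_eq_of_card_lt_of_maps_to
      (s := Finset.range (q + 1)) (t := Finset.range q) (by simp)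
      (f := fun k => (∑ t ∈ I k, w t) % q)
      (fun k _ => Finset.mem_coe.2 (Finset.mem_range.2 (Nat.mod_lt _ hq)))
    rw [Finset.mem_range] at hk hl
    rcases hne.lt_or_gt with h | h
    · exact ⟨k, l, h, by omega, heq⟩
    · exact ⟨l, k, h, by omega, heq.symm⟩
  have hsub : I k ⊆ I l := fun t ht => by
    simp only [I, Finset.mem_filter, Finset.mem_univ, true_and] at ht ⊢
    omega
  set J := I l \ I k with hJ
  have hsum : ∀ u : ι → ℕ, ∑ j, u j * (J.filter fun t => (f t).1 = j).card =
      ∑ t ∈ J, u (f t).1 := by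
    intro u
    rw [← Finset.sum_fiberwise J (fun t => (f t).1)]
    refine Finset.sum_congr rfl fun j _ => ?_
    rw [Finset.sum_congr rfl fun t ht => by rw [(Finset.mem_filter.1 ht).2], Finset.sum_const,
      smul_eq_mul, mul_comm]
  have hcard : ∑ j, (J.filter fun t => (f t).1 = j).card = J.card := by
    simpa using hsum fun _ => 1
  refine ⟨fun j => (J.filter fun t => (f t).1 = j).card, fun j => ?_, fun h0 => ?_, ?_, ?_⟩
  · have : (J.filter fun t => (f t).1 = j).card ≤
        (Finset.univ.map (Function.Embedding.sigmaMk (β := fun j => Fin (v j)) j)).card := by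
      refine Finset.card_le_card_of_injOn f (fun t ht => ?_) f.injective.injOn
      have htj := (Finset.mem_filter.1 ht).2
      rw [Finset.mem_coe, Finset.mem_map]
      exact ⟨htj ▸ (f t).2, Finset.mem_univ _, by subst htj; rfl⟩
    simpa using this
  · have hJ0 : J.card = 0 := by
      rw [← hcard]
      exact Finset.sum_eq_zero fun j _ => congrFun h0 j
    have : (⟨k, by omega⟩ : Fin q) ∈ J := by simp [hJ, I, hkl]
    rw [Finset.card_eq_zero] at hJ0
    simp [hJ0] at this
  · rw [hcard]
    simpa using Finset.card_le_univ J
  · rw [hsum p]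
    have h1 : ∑ t ∈ J, w t + ∑ t ∈ I k, w t = ∑ t ∈ I l, w t := Finset.sum_sdiff hsub
    have h2 : ∑ t ∈ J, w t = ∑ t ∈ I l, w t - ∑ t ∈ I k, w t := by omega
    change q ∣ ∑ t ∈ J, w t
    rw [h2]
    exact (Nat.modEq_iff_dvd' (by omega)).1 hmod

/-- An element `g` of the Graver basis of a positive row has no entry larger than all entries of
the row: otherwise, among its negative entries there are at least `p i` units, and some of them
have a total weight divisible by `p i`, so that they cancel against a few units at `i`. -/
theorem gInf_row_le {ι : Type} [Fintype ι] (p : ι → ℕ) (hp : ∀ j, 0 < p j) {c : ℕ}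
    (hc : ∀ j, p j ≤ c) : gInf (fun (_ : Fin 1) j => (p j : ℤ)) ≤ c := by
  classical
  refine gInf_le fun g hg i => ?_
  by_contra! hgi
  have hker : ∀ x : ι → ℤ,
      Matrix.mulVec (fun (_ : Fin 1) j => (p j : ℤ)) x = 0 ↔ ∑ j, (p j : ℤ) * x j = 0 := by
    intro x
    exact ⟨fun h => congrFun h 0, fun h => funext fun _ => h⟩
  have hg0 := (hker g).1 hg.2.1
  let v : ι → ℕ := fun j => (-(g j)).toNat
  have hvi : v i = 0 := by simp only [v]; omega
  have hpv : p i * c < ∑ j, p j * v j := by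
    have h1 : ∑ j, (p j : ℤ) * v j = ∑ j, (p j : ℤ) * ((g j).toNat : ℤ) := by
      rw [← sub_eq_zero, ← Finset.sum_sub_distrib, ← neg_eq_zero, ← Finset.sum_neg_distrib, ← hg0]
      refine Finset.sum_congr rfl fun j _ => ?_
      rw [← mul_sub, ← mul_neg]
      congr 1
      simp only [v]
      omega
    have h2 : (p i : ℤ) * ((g i).toNat : ℤ) ≤ ∑ j, (p j : ℤ) * ((g j).toNat : ℤ) :=
      Finset.single_le_sum (f := fun j => (p j : ℤ) * ((g j).toNat : ℤ))
        (fun j _ => by positivity) (Finset.mem_univ i)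
    have h3 : (p i : ℤ) * c < p i * ((g i).toNat : ℤ) :=
      mul_lt_mul_of_pos_left (by omega) (by exact_mod_cast hp i)
    zify
    omega
  have hv : p i ≤ ∑ j, v j := by
    have h1 : ∑ j, p j * v j ≤ c * ∑ j, v j := by
      rw [Finset.mul_sum]
      exact Finset.sum_le_sum fun j _ => Nat.mul_le_mul_right _ (hc j)
    have h2 : c * p i < c * ∑ j, v j := by rw [mul_comm c (p i)]; omega
    exact (lt_of_mul_lt_mul_left h2 (Nat.zero_le c)).le
  obtain ⟨h, hhv, hh0, hhq, k, hk⟩ := exists_le_dvd_sum p v (hp i) hv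
  have hkc : k ≤ c := by
    have h1 : ∑ j, p j * h j ≤ c * ∑ j, h j := by
      rw [Finset.mul_sum]
      exact Finset.sum_le_sum fun j _ => Nat.mul_le_mul_right _ (hc j)
    have h2 : p i * k ≤ p i * c := by
      rw [← hk, mul_comm (p i)]
      exact h1.trans (Nat.mul_le_mul_left c hhq)
    exact le_of_mul_le_mul_left h2 (hp i)
  have hhi : h i = 0 := by
    have : h i ≤ v i := hhv i
    omega
  let e : ι → ℤ := fun j => (if j = i then (k : ℤ) else 0) - h j
  have hei : e i = k := by simp [e, hhi]
  have hej : ∀ j, j ≠ i → e j = -(h j : ℤ) := fun j hj => by simp [e, hj]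
  have heg : e = g := by
    refine hg.2.2 e (fun h0 => hh0 ?_) ((hker e).2 ?_) (signCompat_iff.2 fun j => ?_)
    · funext j
      by_cases hj : j = i
      · rw [hj, hhi]; rfl
      · have h1 := congrFun h0 j
        rw [hej j hj] at h1
        simpa using h1
    · simp only [e, mul_sub, Finset.sum_sub_distrib, mul_ite, mul_zero, Finset.sum_ite_eq',
        Finset.mem_univ, if_true]
      rw [sub_eq_zero]
      exact_mod_cast hk.symm
    · by_cases hj : j = i
      · subst hj
        rw [hei]
        omega
      · have h1 : h j ≤ (-(g j)).toNat := hhv j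
        rw [hej j hj]
        omega
  rw [← heg, hei] at hgi
  omega

/-! ### Balanced schedules -/

namespace Instance

variable {o : Objective} {d m : ℕ}

/-- Half of `Instance.jobBound`: a bound on the differences between the machines in a balanced
schedule. -/
def halfBound (I : Instance o d m) : ℕ := 2 * d * (4 * I.pMax + 1) ^ 2

theorem p_le_pMax (I : Instance o d m) (j : Fin d) : I.p j ≤ I.pMax :=
  Finset.le_sup (f := I.p) (Finset.mem_univ j)

theorem pMax_pos (I : Instance o d m) : 0 < I.pMax :=
  (I.p_pos ⟨0, I.d_pos⟩).trans_le (I.p_le_pMax _)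

theorem jobBound_eq (I : Instance o d m) : I.jobBound = 2 * I.halfBound := by
  rw [jobBound, halfBound]; ring

theorem loadBound_eq (I : Instance o d m) : I.loadBound = d * I.pMax * I.jobBound := by
  rw [loadBound, jobBound]; ring

theorem halfBound_pos (I : Instance o d m) : 0 < I.halfBound := by
  have := I.d_pos
  rw [halfBound]
  positivity

/-- Any schedule can be balanced without leaving an interval that contains all its loads. The
bricks of the integer program consist of the job numbers of a machine and of its slack below the
upper end of the interval. -/
theorem exists_balanced_schedule (I : Instance o d m) (y : Fin m → Fin d → ℕ) (l u : ℕ)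
    (hy : ∀ i, l ≤ I.load y i ∧ I.load y i ≤ u) :
    ∃ z : Fin m → Fin d → ℕ, (∀ j, ∑ i, z i j = ∑ i, y i j) ∧
      (∀ i, l ≤ I.load z i ∧ I.load z i ≤ u) ∧ ∀ i i' j, z i j ≤ z i' j + I.halfBound := by
  let q : Option (Fin d) → ℕ := fun j => j.elim 1 I.p
  let B : Matrix (Fin 1) (Option (Fin d)) ℤ := fun _ j => q j
  let S : Option (Fin d) → Set ℤ := fun j => j.elim (Set.Icc 0 (u - l : ℤ)) fun _ => Set.Ici 0
  let x : Fin m → Option (Fin d) → ℤ := fun i j => j.elim ((u : ℤ) - I.load y i) fun j => y i j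
  have hB : ∀ w : Option (Fin d) → ℤ, B.mulVec w 0 = w none + ∑ j, (I.p j : ℤ) * w (some j) := by
    intro w
    simp [B, q, Matrix.mulVec, dotProduct, Fintype.sum_option]
  have hg : gInf B ≤ I.pMax := gInf_row_le q
    (fun j => by cases j with | none => exact one_pos | some j => exact I.p_pos j)
    (fun j => by cases j with | none => exact I.pMax_pos | some j => exact I.p_le_pMax j)
  obtain ⟨z, hzB, hzS, hzsum, hz⟩ := exists_balanced B S
    (fun j => by cases j with
      | none => exact Set.ordConnected_Icc
      | some j => exact Set.ordConnected_Ici)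
    (fun _ => u) x
    (fun i => funext fun k => by
      rw [Subsingleton.elim k 0, hB]
      simp [x, load])
    (fun i j => by
      have := hy i
      cases j with
      | none => exact ⟨by simp only [x, Option.elim]; omega, by simp only [x, Option.elim]; omega⟩
      | some j => exact Int.natCast_nonneg _)
  have hcast : ∀ i j, ((z i (some j)).toNat : ℤ) = z i (some j) := fun i j =>
    Int.toNat_of_nonneg (hzS i (some j))
  refine ⟨fun i j => (z i (some j)).toNat, fun j => ?_, fun i => ?_, fun i i' j => ?_⟩
  · zify
    simp only [hcast]
    exact hzsum (some j)
  · have h1 : z i none + ∑ j, (I.p j : ℤ) * z i (some j) = u := by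
      rw [← hB, hzB]
    have h2 : 0 ≤ z i none ∧ z i none ≤ u - l := hzS i none
    have h3 : ((I.load (fun i j => (z i (some j)).toNat) i : ℕ) : ℤ) =
        ∑ j, (I.p j : ℤ) * z i (some j) := by
      rw [load]
      push_cast
      simp only [hcast]
    omega
  · have h1 := (le_abs_self _).trans (hz i i' (some j))
    have h2 : Fintype.card (Option (Fin d)) * gInf B ≤ I.halfBound := by
      rw [Fintype.card_option, Fintype.card_fin, halfBound]
      refine Nat.mul_le_mul (by have := I.d_pos; omega) (hg.trans ?_)
      nlinarith
    have h3 := hcast i j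
    have h4 := hcast i' j
    zify at h2 ⊢
    omega

/-- A yes-instance has a balanced solution. -/
theorem IsYes.exists_balanced {I : Instance o d m} (hI : I.IsYes) :
    ∃ y, I.IsSolution y ∧ ∀ i i' j, y i j ≤ y i' j + I.halfBound := by
  obtain ⟨y, hyn, hyT⟩ := hI
  have key : ∀ l u : ℕ, (∀ i, l ≤ I.load y i ∧ I.load y i ≤ u) →
      (∀ z : Fin m → Fin d → ℕ, (∀ i, l ≤ I.load z i ∧ I.load z i ≤ u) → o.Meets I.T (I.load z)) →
      ∃ y, I.IsSolution y ∧ ∀ i i' j, y i j ≤ y i' j + I.halfBound := by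
    intro l u h1 h2
    obtain ⟨z, hzn, hz, hbal⟩ := I.exists_balanced_schedule y l u h1
    exact ⟨z, ⟨fun j => (hzn j).trans (hyn j), h2 z hz⟩, hbal⟩
  cases o with
  | cmax =>
    exact key 0 _ (fun i => ⟨Nat.zero_le _, hyT i⟩) fun z hz i => (hz i).2
  | cmin =>
    exact key _ (Finset.univ.sup (I.load y))
      (fun i => ⟨hyT i, Finset.le_sup (f := I.load y) (Finset.mem_univ i)⟩) fun z hz i => (hz i).1
  | envy =>
    obtain ⟨i₀, _, h₀⟩ := Finset.exists_min_image Finset.univ (I.load y)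
      ⟨⟨0, I.m_pos⟩, Finset.mem_univ _⟩
    exact key (I.load y i₀) (I.load y i₀ + I.T (0 : Fin 1))
      (fun i => ⟨h₀ i (Finset.mem_univ i), hyT i i₀⟩) fun z hz i i' => by
        have := hz i
        have := hz i'
        omega
  | window =>
    exact key _ _ hyT fun z hz => hz

/-! ### The kernel -/

/-- The number of jobs of type `j` that every machine gets in advance: every machine has at least
that many in a balanced schedule. -/
def preassigned (I : Instance o d m) (j : Fin d) : ℕ := I.n j / m - I.halfBound

/-- The load of every machine due to the jobs assigned in advance. -/
def preload (I : Instance o d m) : ℕ := ∑ j, I.p j * I.preassigned j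

/-- The amount by which the thresholds drop when all loads drop by `Instance.preload`; the
thresholds of the objective `envy` bound differences of loads and do not change. -/
def shift (I : Instance o d m) : ℕ :=
  match o with
  | .envy => 0
  | _ => I.preload

theorem mul_preassigned_lt (I : Instance o d m) (j : Fin d) : m * I.preassigned j < I.n j := by
  have h0 := I.n_pos j
  have h1 : m * (I.n j / m) ≤ I.n j := Nat.mul_div_le _ _
  have h2 := I.halfBound_pos
  have h3 := I.m_pos
  rw [preassigned]
  rcases le_or_gt (I.n j / m) I.halfBound with h | h
  · rw [Nat.sub_eq_zero_of_le h]
    simpa using h0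
  · exact (Nat.mul_lt_mul_of_pos_left (by omega) h3).trans_le h1

/-- The kernel: assign `I.preassigned j` jobs of each type `j` to every machine, lower the
thresholds accordingly, and cut them off at the bound on the loads of a balanced schedule. -/
def kernel (d m : ℕ) (I : Instance o d m) : Instance o d m where
  p := I.p
  n j := I.n j - m * I.preassigned j
  T k := min (I.T k - I.shift) I.loadBound
  d_pos := I.d_pos
  m_pos := I.m_pos
  p_pos := I.p_pos
  n_pos j := Nat.sub_pos_of_lt (I.mul_preassigned_lt j)

theorem kernel_n_add (I : Instance o d m) (j : Fin d) :
    I.n j = (kernel d m I).n j + m * I.preassigned j :=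
  (Nat.sub_add_cancel (I.mul_preassigned_lt j).le).symm

theorem kernel_n_lt (I : Instance o d m) (j : Fin d) : (kernel d m I).n j < m * I.jobBound := by
  have h1 : I.n j < m * (I.n j / m + 1) := Nat.lt_mul_div_succ _ I.m_pos
  have h2 := I.kernel_n_add j
  have h3 := I.halfBound_pos
  have h4 : m * (I.n j / m + 1) ≤ m * (I.jobBound + I.preassigned j) := by
    refine Nat.mul_le_mul_left m ?_
    rw [jobBound_eq, preassigned]
    omega
  rw [mul_add m I.jobBound] at h4
  omega

theorem load_add_preassigned (I : Instance o d m) (y : Fin m → Fin d → ℕ) (i : Fin m) :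
    I.load (fun i j => y i j + I.preassigned j) i = I.load y i + I.preload := by
  simp only [load, preload, mul_add, Finset.sum_add_distrib]

theorem load_kernel (I : Instance o d m) : (kernel d m I).load = I.load := rfl

/-- The number of jobs is positive, so that some machine has a positive load. -/
theorem exists_load_pos (I : Instance o d m) {y : Fin m → Fin d → ℕ}
    (hy : ∀ j, ∑ i, y i j = I.n j) : ∃ i, 0 < I.load y i := by
  have h := I.n_pos ⟨0, I.d_pos⟩
  rw [← hy] at h
  obtain ⟨i, _, hi⟩ := Finset.exists_ne_zero_of_sum_ne_zero h.ne'
  refine ⟨i, lt_of_lt_of_le (Nat.mul_pos (I.p_pos ⟨0, I.d_pos⟩) (Nat.pos_of_ne_zero hi)) ?_⟩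
  exact Finset.single_le_sum (f := fun j => I.p j * y i j) (fun j _ => Nat.zero_le _)
    (Finset.mem_univ _)

/-- The kernel has too few jobs for the load of every machine to reach the cut-off. -/
theorem exists_load_lt_loadBound (I : Instance o d m) {y : Fin m → Fin d → ℕ}
    (hy : ∀ j, ∑ i, y i j = (kernel d m I).n j) : ∃ i, I.load y i < I.loadBound := by
  by_contra! h
  have h1 : m * I.loadBound ≤ ∑ i, I.load y i := by
    simpa using Finset.sum_le_sum fun i (_ : i ∈ Finset.univ) => h i
  have h2 : ∑ i, I.load y i = ∑ j, I.p j * (kernel d m I).n j := by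
    simp only [load]
    rw [Finset.sum_comm]
    simp only [← Finset.mul_sum, hy]
  have h3 : ∑ j, I.p j * (kernel d m I).n j < ∑ _j : Fin d, I.pMax * (m * I.jobBound) := by
    refine Finset.sum_lt_sum_of_nonempty ⟨⟨0, I.d_pos⟩, Finset.mem_univ _⟩ fun j _ => ?_
    exact (Nat.mul_le_mul_right _ (I.p_le_pMax j)).trans_lt
      (Nat.mul_lt_mul_of_pos_left (I.kernel_n_lt j) I.pMax_pos)
  have h4 : ∑ _j : Fin d, I.pMax * (m * I.jobBound) = m * I.loadBound := by
    rw [Finset.sum_const, Finset.card_univ, Fintype.card_fin, smul_eq_mul, loadBound_eq]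
    ring
  omega

/-- Solutions of the kernel extend to solutions of the instance. Where the truncation of the
thresholds loses information, the kernel has no solution: with a threshold `0` above, because some
load is positive, and with a cut-off threshold below, because some load is smaller. -/
theorem isSolution_of_kernel (I : Instance o d m) {y : Fin m → Fin d → ℕ}
    (hy : (kernel d m I).IsSolution y) : I.IsSolution fun i j => y i j + I.preassigned j := by
  obtain ⟨hyn, hyT⟩ := hy
  rw [load_kernel] at hyT
  refine ⟨fun j => ?_, ?_⟩
  · rw [I.kernel_n_add, ← hyn, Finset.sum_add_distrib]
    simp
  obtain ⟨i₀, h₀⟩ := (kernel d m I).exists_load_pos hyn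
  obtain ⟨i₁, h₁⟩ := I.exists_load_lt_loadBound hyn
  rw [load_kernel] at h₀
  have hload := I.load_add_preassigned y
  cases o with
  | cmax =>
    intro i
    have h2 : ∀ i, I.load y i ≤ min (I.T (0 : Fin 1) - I.preload) I.loadBound := hyT
    have := h2 i
    have := h2 i₀
    rw [hload]
    omega
  | cmin =>
    intro i
    have h2 : ∀ i, min (I.T (0 : Fin 1) - I.preload) I.loadBound ≤ I.load y i := hyT
    have := h2 i
    have := h2 i₁
    rw [hload]
    omega
  | envy =>
    intro i i'
    have h2 : ∀ i i', I.load y i ≤ I.load y i' + min (I.T (0 : Fin 1) - 0) I.loadBound := hyT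
    have := h2 i i'
    rw [hload, hload]
    omega
  | window =>
    intro i
    have h2 : ∀ i, min (I.T (0 : Fin 2) - I.preload) I.loadBound ≤ I.load y i ∧
        I.load y i ≤ min (I.T (1 : Fin 2) - I.preload) I.loadBound := hyT
    have := h2 i
    have := h2 i₀
    have := h2 i₁
    rw [hload]
    omega

/-- A balanced solution of the instance contains the jobs assigned in advance and leaves a solution
of the kernel with few jobs on every machine. -/
theorem exists_isSolution_kernel (I : Instance o d m) (hI : I.IsYes) :
    ∃ y, (kernel d m I).IsSolution y ∧ (∀ i j, y i j ≤ I.jobBound) ∧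
      ∀ i, (kernel d m I).load y i ≤ I.loadBound := by
  obtain ⟨y, ⟨hyn, hyT⟩, hbal⟩ := hI.exists_balanced
  -- Compare the entries for type `j` with their average `I.n j / m`.
  have hle : ∀ i j, I.n j / m ≤ y i j + I.halfBound := by
    intro i j
    refine Nat.div_le_of_le_mul ?_
    rw [← hyn]
    simpa using Finset.sum_le_sum fun k (_ : k ∈ Finset.univ) => hbal k i j
  have hge : ∀ i j, y i j ≤ I.n j / m + I.halfBound := by
    intro i j
    rw [← Nat.sub_le_iff_le_add, Nat.le_div_iff_mul_le I.m_pos, ← hyn, mul_comm]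
    simpa using Finset.sum_le_sum fun k (_ : k ∈ Finset.univ) =>
      Nat.sub_le_iff_le_add.2 (hbal i k j)
  have hpre : ∀ i j, I.preassigned j ≤ y i j := fun i j => by
    have := hle i j
    rw [preassigned]
    omega
  obtain ⟨z, rfl⟩ : ∃ z : Fin m → Fin d → ℕ, y = fun i j => z i j + I.preassigned j :=
    ⟨fun i j => y i j - I.preassigned j, by
      funext i j
      exact (Nat.sub_add_cancel (hpre i j)).symm⟩
  have hz : ∀ i j, z i j ≤ I.jobBound := fun i j => by
    have := hge i j
    rw [jobBound_eq]
    simp only [preassigned] at this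
    omega
  have hzl : ∀ i, I.load z i ≤ I.loadBound := fun i => by
    refine (Finset.sum_le_sum fun j _ => Nat.mul_le_mul (I.p_le_pMax j) (hz i j)).trans ?_
    rw [Finset.sum_const, Finset.card_univ, Fintype.card_fin, smul_eq_mul, loadBound_eq, mul_assoc]
  refine ⟨z, ⟨fun j => ?_, ?_⟩, hz, hzl⟩
  · have h1 := hyn j
    rw [Finset.sum_add_distrib, I.kernel_n_add] at h1
    simpa using h1
  rw [load_kernel]
  have hload := I.load_add_preassigned z
  cases o with
  | cmax =>
    intro i
    have h1 := hyT i
    rw [hload] at h1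
    exact le_min (by change _ ≤ I.T (0 : Fin 1) - I.preload; omega) (hzl i)
  | cmin =>
    intro i
    have h1 := hyT i
    rw [hload] at h1
    exact (min_le_left _ _).trans (by change I.T (0 : Fin 1) - I.preload ≤ _; omega)
  | envy =>
    intro i i'
    have h1 := hyT i i'
    rw [hload, hload] at h1
    have := hzl i
    change _ ≤ _ + min (I.T (0 : Fin 1) - 0) I.loadBound
    omega
  | window =>
    intro i
    have h1 := hyT i
    rw [hload] at h1
    exact ⟨(min_le_left _ _).trans (by change I.T (0 : Fin 2) - I.preload ≤ _; omega),
      le_min (by change _ ≤ I.T (1 : Fin 2) - I.preload; omega) (hzl i)⟩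

theorem isYes_iff_kernel (I : Instance o d m) : I.IsYes ↔ (kernel d m I).IsYes :=
  ⟨fun h => let ⟨y, hy, _⟩ := I.exists_isSolution_kernel h; ⟨y, hy⟩,
    fun ⟨_, hy⟩ => ⟨_, I.isSolution_of_kernel hy⟩⟩

theorem kernel_T_le (I : Instance o d m) (k : Fin o.arity) : (kernel d m I).T k ≤ I.loadBound :=
  min_le_right _ _

theorem _root_.Nat.size_le_self (n : ℕ) : n.size ≤ n := Nat.size_le.2 n.lt_two_pow_self

theorem _root_.Objective.arity_le_two (o : Objective) : o.arity ≤ 2 := by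
  cases o <;> decide

theorem size_kernel_le (I : Instance o d m) :
    (kernel d m I).size ≤ 400 * (d + m + I.pMax) ^ 5 := by
  set P := d + m + I.pMax with hP
  have hd : d ≤ P := by omega
  have hm : m ≤ P := by omega
  have hp : I.pMax ≤ P := by omega
  have hP1 : 1 ≤ P := by have := I.d_pos; omega
  have hsq : (4 * I.pMax + 1) ^ 2 ≤ 25 * P ^ 2 := by
    calc (4 * I.pMax + 1) ^ 2 ≤ (5 * P) ^ 2 := Nat.pow_le_pow_left (by omega) 2
      _ = _ := by ring
  have hK : I.jobBound ≤ 100 * P ^ 3 := by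
    calc I.jobBound ≤ 4 * P * (25 * P ^ 2) := Nat.mul_le_mul (by omega) hsq
      _ = _ := by ring
  have hL : I.loadBound ≤ 100 * P ^ 5 := by
    rw [loadBound_eq]
    calc d * I.pMax * I.jobBound ≤ P * P * (100 * P ^ 3) := by gcongr
      _ = _ := by ring
  have hjobs : ∑ j, (Nat.size ((kernel d m I).p j) + Nat.size ((kernel d m I).n j)) ≤
      P * (P + P * (100 * P ^ 3)) := by
    calc _ ≤ ∑ _j : Fin d, (P + P * (100 * P ^ 3)) := Finset.sum_le_sum fun j _ =>
          add_le_add ((Nat.size_le_self _).trans ((I.p_le_pMax j).trans hp))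
            ((Nat.size_le_self _).trans ((I.kernel_n_lt j).le.trans (Nat.mul_le_mul hm hK)))
      _ = d * (P + P * (100 * P ^ 3)) := by simp
      _ ≤ _ := Nat.mul_le_mul_right _ hd
  have hthr : ∑ k, Nat.size ((kernel d m I).T k) ≤ 2 * (100 * P ^ 5) := by
    calc _ ≤ ∑ _k : Fin o.arity, 100 * P ^ 5 := Finset.sum_le_sum fun k _ =>
          (Nat.size_le_self _).trans ((I.kernel_T_le k).trans hL)
      _ = o.arity * (100 * P ^ 5) := by simp
      _ ≤ _ := Nat.mul_le_mul_right _ o.arity_le_two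
  have h1 : P ≤ P ^ 5 := Nat.le_self_pow (by norm_num) P
  have h2 : P ^ 2 ≤ P ^ 5 := Nat.pow_le_pow_right hP1 (by norm_num)
  have h3 : P * (P + P * (100 * P ^ 3)) = P ^ 2 + 100 * P ^ 5 := by ring
  have h4 := Nat.size_le_self d
  have h5 := Nat.size_le_self m
  rw [size]
  omega

theorem isKernelization_kernel : IsKernelization (kernel (o := o)) := by
  refine ⟨fun d m I => I.isYes_iff_kernel, fun P => 400 * P ^ 5, ?_, fun d m I => I.size_kernel_le⟩
  have h : Primrec fun P : ℕ => 400 * (P * P * (P * P) * P) :=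
    Primrec.nat_mul.comp (Primrec.const 400) (Primrec.nat_mul.comp (Primrec.nat_mul.comp
      (Primrec.nat_mul.comp Primrec.id Primrec.id) (Primrec.nat_mul.comp Primrec.id Primrec.id))
      Primrec.id)
  exact (h.of_eq fun P => by ring).to_comp

end Instance

/-! ### Reasoning about programs -/

@[simp]
theorem RamState.reg_setReg (σ : RamState) (r v a : ℕ) :
    (σ.setReg r v).reg a = if a = r then v else σ.reg a :=
  Function.update_apply _ _ _ _

@[simp]
theorem RamState.mem_setReg (σ : RamState) (r v : ℕ) : (σ.setReg r v).mem = σ.mem := rfl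

@[simp]
theorem RamState.reg_setMem (σ : RamState) (a v : ℕ) : (σ.setMem a v).reg = σ.reg := rfl

@[simp]
theorem RamState.mem_setMem (σ : RamState) (a v b : ℕ) :
    (σ.setMem a v).mem b = if b = a then v else σ.mem b :=
  Function.update_apply _ _ _ _

namespace RamProg

/-- Started in `σ`, the program `P` halts after at most `t` steps, in a state that satisfies `Q`,
and it writes no number larger than `W`. -/
def Reaches (W : ℕ) (P : RamProg) (σ : RamState) (t : ℕ) (Q : RamState → Prop) : Prop :=
  ∃ s τ, s ≤ t ∧ P.Runs W σ s τ ∧ Q τ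

infixr:60 " ;; " => RamProg.seq

variable {W t u : ℕ} {P P' : RamProg} {σ : RamState} {Q Q' : RamState → Prop}

namespace Reaches

theorem mono (h : Reaches W P σ t Q) (htu : t ≤ u) : Reaches W P σ u Q :=
  let ⟨s, τ, hs, hP, hQ⟩ := h
  ⟨s, τ, hs.trans htu, hP, hQ⟩

theorem imp (h : Reaches W P σ t Q) (hQ : ∀ τ, Q τ → Q' τ) : Reaches W P σ t Q' :=
  let ⟨s, τ, hs, hP, hτ⟩ := h
  ⟨s, τ, hs, hP, hQ τ hτ⟩

theorem seq (h : Reaches W P σ t Q) (h' : ∀ τ, Q τ → Reaches W P' τ u Q') :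
    Reaches W (P ;; P') σ (t + u) Q' := by
  obtain ⟨s, τ, hs, hP, hQ⟩ := h
  obtain ⟨s', τ', hs', hP', hQ'⟩ := h' τ hQ
  exact ⟨s + s', τ', add_le_add hs hs', .seq _ _ _ _ _ _ _ hP hP', hQ'⟩

theorem const {r c : ℕ} (h : c ≤ W) (hQ : Q (σ.setReg r c)) : Reaches W (.const r c) σ 1 Q :=
  ⟨1, _, le_rfl, .const r c σ h, hQ⟩

theorem arith {op : RamOp} {r a b : ℕ} (h : op.eval (σ.reg a) (σ.reg b) ≤ W)
    (hQ : Q (σ.setReg r (op.eval (σ.reg a) (σ.reg b)))) : Reaches W (.arith op r a b) σ 1 Q :=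
  ⟨1, _, le_rfl, .arith op r a b σ h, hQ⟩

theorem load {r a : ℕ} (h : σ.mem (σ.reg a) ≤ W) (hQ : Q (σ.setReg r (σ.mem (σ.reg a)))) :
    Reaches W (.load r a) σ 1 Q :=
  ⟨1, _, le_rfl, .load r a σ h, hQ⟩

theorem store {a r : ℕ} (h : σ.reg r ≤ W) (hQ : Q (σ.setMem (σ.reg a) (σ.reg r))) :
    Reaches W (.store a r) σ 1 Q :=
  ⟨1, _, le_rfl, .store a r σ h, hQ⟩

theorem const_seq {r c : ℕ} (h : c ≤ W) (hP : Reaches W P (σ.setReg r c) t Q) :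
    Reaches W (.const r c ;; P) σ (t + 1) Q :=
  (seq (const h rfl : Reaches W _ σ 1 fun τ => τ = _) fun _ hτ => hτ ▸ hP).mono (add_comm _ _).le

theorem arith_seq {op : RamOp} {r a b : ℕ} (h : op.eval (σ.reg a) (σ.reg b) ≤ W)
    (hP : Reaches W P (σ.setReg r (op.eval (σ.reg a) (σ.reg b))) t Q) :
    Reaches W (.arith op r a b ;; P) σ (t + 1) Q :=
  (seq (arith h rfl : Reaches W _ σ 1 fun τ => τ = _) fun _ hτ => hτ ▸ hP).mono (add_comm _ _).le

theorem load_seq {r a : ℕ} (h : σ.mem (σ.reg a) ≤ W)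
    (hP : Reaches W P (σ.setReg r (σ.mem (σ.reg a))) t Q) :
    Reaches W (.load r a ;; P) σ (t + 1) Q :=
  (seq (load h rfl : Reaches W _ σ 1 fun τ => τ = _) fun _ hτ => hτ ▸ hP).mono (add_comm _ _).le

theorem store_seq {a r : ℕ} (h : σ.reg r ≤ W)
    (hP : Reaches W P (σ.setMem (σ.reg a) (σ.reg r)) t Q) :
    Reaches W (.store a r ;; P) σ (t + 1) Q :=
  (seq (store h rfl : Reaches W _ σ 1 fun τ => τ = _) fun _ hτ => hτ ▸ hP).mono (add_comm _ _).le

/-- A loop whose register counts down to `0`, with the invariant `Inv k` when `k` rounds are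
left. -/
theorem countdown {r n : ℕ} {Inv : ℕ → RamState → Prop} (hr : ∀ k τ, Inv k τ → τ.reg r = k)
    (hstep : ∀ k < n, ∀ τ, Inv (k + 1) τ → Reaches W P τ t (Inv k)) (h : Inv n σ) :
    Reaches W (.loop r P) σ (n * (t + 1) + 1) (Inv 0) := by
  induction n generalizing σ with
  | zero => exact ⟨1, σ, by omega, by constructor; exact hr 0 σ h, h⟩
  | succ n ih =>
    obtain ⟨s, τ, hs, hP, hτ⟩ := hstep n n.lt_succ_self σ h
    obtain ⟨s', υ, hs', hL, hυ⟩ := ih (fun k hk => hstep k (hk.trans n.lt_succ_self)) hτ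
    exact ⟨s + s' + 1, υ, by rw [Nat.succ_mul]; omega,
      .loop_step r P σ τ υ s s' (by rw [hr _ _ h]; exact n.succ_ne_zero) hP hL, hυ⟩

end Reaches

end RamProg

/-! ### The program that computes the kernel -/

open RamProg

/-- The factor by which the load assigned in advance enters into the thresholds. -/
def Objective.shiftFactor : Objective → ℕ
  | .envy => 0
  | _ => 1

/-- Register `4` becomes the largest processing time; register `7` holds `1` from now on. -/
def maxProg : RamProg :=
  .const 7 1 ;; .const 4 0 ;; .arith .add 5 0 4 ;;
  .loop 5 (.arith .sub 5 5 7 ;; .load 8 5 ;; .arith .sub 9 8 4 ;; .arith .add 4 4 9)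

/-- Registers `6` and `9` become `Instance.halfBound` and `Instance.loadBound`. -/
def boundProg : RamProg :=
  .const 8 4 ;; .arith .mul 8 8 4 ;; .arith .add 8 8 7 ;; .arith .mul 8 8 8 ;;
  .arith .mul 8 8 0 ;; .arith .add 6 8 8 ;; .arith .add 8 6 6 ;; .arith .mul 8 8 4 ;;
  .arith .mul 9 8 0

/-- The job numbers in the memory are reduced by the jobs assigned in advance, and register `10`
becomes `Instance.preload`. -/
def jobsProg : RamProg :=
  .const 10 0 ;; .arith .add 5 0 10 ;;
  .loop 5 (.arith .sub 5 5 7 ;; .arith .add 11 0 5 ;; .load 12 11 ;; .arith .div 13 12 1 ;;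
    .arith .sub 13 13 6 ;; .arith .mul 8 13 1 ;; .arith .sub 12 12 8 ;; .store 11 12 ;;
    .load 8 5 ;; .arith .mul 8 8 13 ;; .arith .add 10 10 8)

/-- The thresholds are lowered and cut off. For objectives with one threshold, register `3` is `0`
and stays so. -/
def thresholdProg (o : Objective) : RamProg :=
  .const 8 o.shiftFactor ;; .arith .mul 10 10 8 ;;
  .arith .sub 2 2 10 ;; .arith .sub 8 2 9 ;; .arith .sub 2 2 8 ;;
  .arith .sub 3 3 10 ;; .arith .sub 8 3 9 ;; .arith .sub 3 3 8

/-- The program that computes the kernel. -/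
def kernelProg (o : Objective) : RamProg :=
  maxProg ;; boundProg ;; jobsProg ;; thresholdProg o

namespace Instance

variable {o : Objective} {d m W : ℕ}

theorem shift_eq (I : Instance o d m) : I.shift = I.preload * o.shiftFactor := by
  cases o <;> simp [shift, Objective.shiftFactor]

theorem filter_le_eq_insert {k : ℕ} (hk : k < d) :
    (Finset.univ.filter fun j : Fin d => k ≤ j.val) =
      insert ⟨k, hk⟩ (Finset.univ.filter fun j : Fin d => k + 1 ≤ j.val) := by
  ext j
  simp only [Finset.mem_filter, Finset.mem_univ, true_and, Finset.mem_insert, Fin.ext_iff]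
  omega

/-- The registers `0`, …, `3` and the processing times are as in the input, and register `7`
holds `1`. -/
structure Fixed (I : Instance o d m) (σ : RamState) : Prop where
  reg_zero : σ.reg 0 = d
  reg_one : σ.reg 1 = m
  reg_two : σ.reg 2 = I.inputState.reg 2
  reg_three : σ.reg 3 = I.inputState.reg 3
  reg_seven : σ.reg 7 = 1
  mem_p : ∀ j : Fin d, σ.mem j = I.p j

/-- The job numbers are as in the input. -/
def JobsIn (I : Instance o d m) (σ : RamState) : Prop := ∀ j : Fin d, σ.mem (d + j) = I.n j

theorem reaches_maxProg (I : Instance o d m) (hd : d ≤ W) (hp : I.pMax ≤ W) :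
    maxProg.Reaches W I.inputState (d * 5 + 4) fun σ =>
      I.Fixed σ ∧ I.JobsIn σ ∧ σ.reg 4 = I.pMax := by
  have hd0 := I.d_pos
  refine .const_seq (by omega) (.const_seq (Nat.zero_le _) (.arith_seq ?_ ?_))
  · simpa [RamOp.eval, inputState] using hd
  -- With `k` rounds left, register `4` holds the maximum over the types from `k` on.
  let s : ℕ → ℕ := fun k => (Finset.univ.filter fun j : Fin d => k ≤ j.val).sup I.p
  have hs : ∀ k (hk : k < d), s k = max (I.p ⟨k, hk⟩) (s (k + 1)) := fun k hk => by
    simp only [s, filter_le_eq_insert hk, Finset.sup_insert]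
  have hsW : ∀ k, s k ≤ W := fun k => Finset.sup_le fun j _ => (I.p_le_pMax j).trans hp
  refine Reaches.imp (Reaches.countdown (t := 4) (n := d)
    (Inv := fun k σ => I.Fixed σ ∧ I.JobsIn σ ∧ σ.reg 5 = k ∧ σ.reg 4 = s k)
    (fun k σ h => h.2.2.1) ?_ ?_) ?_
  · rintro k hk σ ⟨hf, hj, h5, h4⟩
    have h7 := hf.reg_seven
    have h8 := hf.mem_p ⟨k, hk⟩
    have hsk := hs k hk
    have hpW := (I.p_le_pMax ⟨k, hk⟩).trans hp
    have hskW := hsW (k + 1)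
    refine .arith_seq ?_ (.load_seq ?_ (.arith_seq ?_
      (.arith ?_ ⟨⟨?_, ?_, ?_, ?_, ?_, ?_⟩, ?_, ?_, ?_⟩)))
    all_goals try simp [RamOp.eval, h5, h4, h7, h8, hf.reg_zero, hf.reg_one, hf.reg_two,
      hf.reg_three, hf.mem_p]
    all_goals first | omega | exact hj
  · refine ⟨⟨?_, ?_, ?_, ?_, ?_, fun j => ?_⟩, fun j => ?_, ?_, ?_⟩
    all_goals simp [RamOp.eval, inputState]
    refine (bot_unique (Finset.sup_le fun j hj => ?_)).symm
    have := (Finset.mem_filter.1 hj).2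
    omega
  · rintro σ ⟨hf, hj, -, h4⟩
    exact ⟨hf, hj, by rw [h4]; simp [s, pMax]⟩

theorem reaches_boundProg (I : Instance o d m) (hL : I.loadBound ≤ W) {σ : RamState}
    (hf : I.Fixed σ) (hj : I.JobsIn σ) (h4 : σ.reg 4 = I.pMax) :
    boundProg.Reaches W σ 9 fun σ => I.Fixed σ ∧ I.JobsIn σ ∧
      σ.reg 6 = I.halfBound ∧ σ.reg 9 = I.loadBound := by
  have h0 := hf.reg_zero
  have h7 := hf.reg_seven
  have hd0 := I.d_pos
  have hp0 := I.pMax_pos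
  set q := 4 * I.pMax + 1 with hq
  have hH : q * q * d + q * q * d = I.halfBound := by rw [halfBound]; ring
  have hK : I.halfBound + I.halfBound = I.jobBound := by rw [jobBound_eq]; ring
  have hLeq : I.jobBound * I.pMax * d = I.loadBound := by rw [loadBound_eq]; ring
  have h1 : q ≤ q * q := Nat.le_mul_of_pos_left _ (by omega)
  have h2 : q * q ≤ q * q * d := Nat.le_mul_of_pos_right _ hd0
  have h3 : I.jobBound ≤ I.jobBound * I.pMax := Nat.le_mul_of_pos_right _ hp0
  have h5 : I.jobBound * I.pMax ≤ I.jobBound * I.pMax * d := Nat.le_mul_of_pos_right _ hd0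
  refine .const_seq ?_ (.arith_seq ?_ (.arith_seq ?_ (.arith_seq ?_ (.arith_seq ?_ (.arith_seq ?_
    (.arith_seq ?_ (.arith_seq ?_ (.arith ?_ ⟨⟨?_, ?_, ?_, ?_, ?_, ?_⟩, ?_, ?_, ?_⟩))))))))
  all_goals try simp [RamOp.eval, h0, h4, h7, ← hq, hH, hK, hLeq, hf.reg_one, hf.reg_two,
      hf.reg_three, hf.mem_p]
  all_goals first | omega | exact hj

theorem reaches_jobsProg (I : Instance o d m) (hd : 2 * d ≤ W) (hn : ∀ j, I.n j ≤ W)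
    (hp : I.pMax ≤ W) (hS : I.preload ≤ W) {σ : RamState}
    (hf : I.Fixed σ) (hj : I.JobsIn σ) (h6 : σ.reg 6 = I.halfBound) (h9 : σ.reg 9 = I.loadBound) :
    jobsProg.Reaches W σ (d * 12 + 3) fun σ => I.Fixed σ ∧ (kernel d m I).JobsIn σ ∧
      σ.reg 9 = I.loadBound ∧ σ.reg 10 = I.preload := by
  have h0 := hf.reg_zero
  refine .const_seq (Nat.zero_le _) (.arith_seq ?_ ?_)
  · simp [RamOp.eval, h0]
    omega
  -- With `k` rounds left, the types from `k` on have been dealt with.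
  let s : ℕ → ℕ := fun k =>
    ∑ j ∈ Finset.univ.filter fun j : Fin d => k ≤ j.val, I.p j * I.preassigned j
  have hs : ∀ k (hk : k < d), s k = s (k + 1) + I.p ⟨k, hk⟩ * I.preassigned ⟨k, hk⟩ := fun k hk => by
    simp only [s, filter_le_eq_insert hk]
    rw [Finset.sum_insert (by simp), add_comm]
  have hsW : ∀ k, s k ≤ W := fun k =>
    (Finset.sum_le_sum_of_subset (Finset.filter_subset _ _)).trans hS
  refine Reaches.imp (Reaches.countdown (t := 11) (n := d)
    (Inv := fun k σ => I.Fixed σ ∧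
      (∀ j : Fin d, σ.mem (d + j) = if j.val < k then I.n j else (kernel d m I).n j) ∧
      σ.reg 5 = k ∧ σ.reg 6 = I.halfBound ∧ σ.reg 9 = I.loadBound ∧ σ.reg 10 = s k)
    (fun k σ h => h.2.2.1) ?_ ?_) ?_
  · clear hf hj h6 h9 h0
    rintro k hk σ ⟨hf, hj, h5, h6, h9, h10⟩
    have h0 := hf.reg_zero
    have h1 := hf.reg_one
    have h7 := hf.reg_seven
    have hmp := hf.mem_p ⟨k, hk⟩
    have hmn := hj ⟨k, hk⟩
    simp only [Nat.lt_succ_self, if_true] at hmn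
    have hsk := hs k hk
    have hskW := hsW k
    have hnW := hn ⟨k, hk⟩
    have hpW := (I.p_le_pMax ⟨k, hk⟩).trans hp
    have hlt := I.mul_preassigned_lt ⟨k, hk⟩
    have hdiv : I.n ⟨k, hk⟩ / m ≤ I.n ⟨k, hk⟩ := Nat.div_le_self _ _
    have ha : I.n ⟨k, hk⟩ / m - I.halfBound = I.preassigned ⟨k, hk⟩ := rfl
    have hd0 := I.d_pos.ne'
    rw [mul_comm] at hlt
    refine .arith_seq ?_ (.arith_seq ?_ (.load_seq ?_ (.arith_seq ?_ (.arith_seq ?_ (.arith_seq ?_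
      (.arith_seq ?_ (.store_seq ?_ (.load_seq ?_ (.arith_seq ?_ (.arith ?_
        ⟨⟨?_, ?_, ?_, ?_, ?_, fun j => ?_⟩, fun j => ?_, ?_, ?_, ?_, ?_⟩))))))))))
    all_goals try simp [RamOp.eval, h0, h1, h5, h6, h7, h9, h10, hmp, hmn, ha, hd0, hf.reg_two,
      hf.reg_three]
    all_goals try omega
    · rw [if_neg (by omega), hf.mem_p]
    · by_cases hjk : j.val = k
      · obtain rfl : j = ⟨k, hk⟩ := Fin.ext hjk
        simp [kernel, mul_comm]
      · rw [if_neg hjk, hj]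
        by_cases hjk' : j.val < k
        · rw [if_pos hjk', if_pos (by omega)]
        · rw [if_neg hjk', if_neg (by omega)]
  · refine ⟨⟨?_, ?_, ?_, ?_, ?_, fun j => ?_⟩, fun j => ?_, ?_, ?_, ?_, ?_⟩
    all_goals simp [RamOp.eval, h0, h6, h9, hf.reg_one, hf.reg_two, hf.reg_three, hf.reg_seven,
      hf.mem_p]
    · exact hj j
    · exact (Finset.sum_eq_zero fun j hj => absurd (Finset.mem_filter.1 hj).2 (by omega)).symm
  · rintro σ ⟨hf, hj, -, -, h9, h10⟩
    refine ⟨hf, fun j => by simpa using hj j, h9, ?_⟩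
    rw [h10]
    simp [s, preload]

theorem reaches_thresholdProg (I : Instance o d m) (hW : 0 < W)
    (hT : ∀ k, I.T k ≤ W) (hS : I.preload ≤ W) {σ : RamState}
    (hf : I.Fixed σ) (hj : (kernel d m I).JobsIn σ) (h9 : σ.reg 9 = I.loadBound)
    (h10 : σ.reg 10 = I.preload) :
    (thresholdProg o).Reaches W σ 8 (kernel d m I).StoredIn := by
  have hsW : I.shift ≤ W := by cases o <;> simp [shift, hS]
  have hfac : o.shiftFactor ≤ W := by cases o <;> simp [Objective.shiftFactor] <;> omega
  have hin : ∀ r, 2 ≤ r → I.inputState.reg r ≤ W := by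
    intro r hr
    simp only [inputState]
    rw [if_neg (by omega), if_neg (by omega)]
    split_ifs
    · exact hT _
    · exact Nat.zero_le _
  have h2W := hin 2 le_rfl
  have h3W := hin 3 (by norm_num)
  have hcut : ∀ x y z : ℕ, x - y - (x - y - z) = min (x - y) z := by omega
  refine .const_seq ?_ (.arith_seq ?_ (.arith_seq ?_ (.arith_seq ?_ (.arith_seq ?_ (.arith_seq ?_
    (.arith_seq ?_ (.arith ?_ ⟨?_, ?_, fun k => ?_, fun j => ?_, fun j => ?_⟩)))))))
  all_goals try simp [RamOp.eval, h9, h10, ← I.shift_eq, hf.reg_zero, hf.reg_one, hf.reg_two,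
      hf.reg_three]
  all_goals try omega
  · have hk := k.2.trans_le o.arity_le_two
    have hk0 : 2 + k.val ≠ 1 := by omega
    have hkT : I.inputState.reg (2 + k) = I.T k := by
      simp [inputState, hk0]
    change _ = min (I.T k - I.shift) I.loadBound
    rw [← hkT, ← hcut]
    obtain hk | hk : k.val = 0 ∨ k.val = 1 := by omega
    · simp [hk]
    · simp [hk]
  · exact hf.mem_p j
  · exact hj j

theorem computableInLinearTime_kernel : ComputableInLinearTime (kernel (o := o)) := by
  refine ⟨kernelProg o, 41, fun d m I => ?_⟩
  set N := I.total with hN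
  set W := N ^ 41 with hWdef
  have hd0 := I.d_pos
  have hm0 := I.m_pos
  have hpn : ∀ j, I.p j + I.n j ≤ ∑ j, (I.p j + I.n j) := fun j =>
    Finset.single_le_sum (f := fun j => I.p j + I.n j) (fun _ _ => Nat.zero_le _)
      (Finset.mem_univ j)
  have hsum : ∑ j, (I.p j + I.n j) + d + m ≤ N := by rw [hN, total]; omega
  have hTN : ∀ k, I.T k ≤ N := fun k => by
    have := Finset.single_le_sum (f := I.T) (fun _ _ => Nat.zero_le _) (Finset.mem_univ k)
    rw [hN, total]
    omega
  have hnN : ∀ j, I.n j ≤ N := fun j => by have := hpn j; omega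
  have hpN : I.pMax + 2 ≤ N := by
    have : I.pMax ≤ ∑ j, (I.p j + I.n j) := Finset.sup_le fun j _ => by have := hpn j; omega
    omega
  have hpW : ∀ k ≤ 41, N ^ k ≤ W := fun k hk => Nat.pow_le_pow_right (by omega) hk
  have hN1 : N ≤ W := by simpa using hpW 1 (by norm_num)
  have hN2 : N * N ≤ W := by simpa [pow_two] using hpW 2 (by norm_num)
  have h2d : 2 * d ≤ W := (Nat.mul_le_mul (by omega) (by omega)).trans hN2
  have hS : I.preload ≤ W := by
    refine le_trans ?_ hN2
    calc I.preload ≤ ∑ j, I.p j * N := Finset.sum_le_sum fun j _ => by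
          refine Nat.mul_le_mul_left _ (le_trans ?_ (hnN j))
          exact (Nat.sub_le _ _).trans (Nat.div_le_self _ _)
      _ = (∑ j, I.p j) * N := by rw [Finset.sum_mul]
      _ ≤ N * N := by
          refine Nat.mul_le_mul_right _ ?_
          rw [Finset.sum_add_distrib] at hsum
          omega
  have hL : I.loadBound ≤ W := by
    refine le_trans ?_ (hpW 9 (by norm_num))
    have h1 : 4 * I.pMax + 1 ≤ N ^ 2 := by nlinarith
    calc I.loadBound ≤ N ^ 2 * N ^ 2 * N * (N ^ 2) ^ 2 := by
          rw [loadBound]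
          gcongr <;> first | omega | nlinarith
      _ = N ^ 9 := by ring
  have h := (I.reaches_maxProg (W := W) (by omega) (by omega)).seq fun σ hσ =>
    (I.reaches_boundProg hL hσ.1 hσ.2.1 hσ.2.2).seq fun σ hσ =>
    (I.reaches_jobsProg h2d (fun j => (hnN j).trans hN1) (by omega) hS hσ.1 hσ.2.1 hσ.2.2.1
      hσ.2.2.2).seq fun σ hσ =>
    I.reaches_thresholdProg (by omega) (fun k => (hTN k).trans hN1) hS hσ.1 hσ.2.1 hσ.2.2.1
      hσ.2.2.2
  obtain ⟨t, τ, ht, hrun, hτ⟩ := h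
  exact ⟨t, τ, by omega, hrun, hτ⟩

end Instance

/-! ### The balancing lemma and the kernels -/

theorem mainTheorem9 :
    -- the balancing lemma
    (∀ (d m s : ℕ) (B : Matrix (Fin s) (Fin (d + 1)) ℤ) (b : Fin d ⊕ Fin m × Fin s → ℤ),
      (∀ (i i' : Fin m) (k : Fin s), b (Sum.inr (i, k)) = b (Sum.inr (i', k))) →
      (∃ x, IsFeasible (nFold m (idZero d) B) b x) →
      ∃ x : Fin m × Fin (d + 1) → ℤ, IsFeasible (nFold m (idZero d) B) b x ∧
        ∀ i i' : Fin m,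
          linfNorm ((fun j => x (i, j)) - (fun j => x (i', j))) ≤ 2 * d * gInf B) ∧
    -- the kernel
    (∀ o : Objective, ∃ κ : (d m : ℕ) → Instance o d m → Instance o d m,
      IsKernelization κ ∧
      ComputableInLinearTime κ ∧
      ∀ (d m : ℕ) (I : Instance o d m),
        -- some solution of the reduced instance, if there is one, obeys the two bounds
        ((κ d m I).IsYes → ∃ y, (κ d m I).IsSolution y ∧
          (∀ i j, y i j ≤ I.jobBound) ∧ (∀ i, (κ d m I).load y i ≤ I.loadBound)) ∧
        -- the numbers in the reduced instance are bounded accordingly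
        (∀ j, (κ d m I).n j ≤ m * I.jobBound) ∧
        (∀ k, (κ d m I).T k ≤ I.loadBound) ∧
        -- the reduced instance is what remains after a pre-assignment of `a j` jobs of type `j`
        -- to every machine, and the pre-assignment completes all of its solutions
        (κ d m I).p = I.p ∧
        ∃ a : Fin d → ℕ, (∀ j, I.n j = (κ d m I).n j + m * a j) ∧
          ∀ y, (κ d m I).IsSolution y → I.IsSolution (fun i j => y i j + a j)) := by
  refine ⟨exists_balanced_nFold, fun o => ⟨Instance.kernel, Instance.isKernelization_kernel,
    Instance.computableInLinearTime_kernel, fun d m I => ⟨fun h => ?_, fun j => ?_, I.kernel_T_le,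
      rfl, I.preassigned, I.kernel_n_add, fun y => I.isSolution_of_kernel⟩⟩⟩
  · exact I.exists_isSolution_kernel (I.isYes_iff_kernel.2 h)
  · exact (I.kernel_n_lt j).le
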